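/- **Setting.** Let $T>0$, let $N,M\ge 0$, $r\ge 1$ and $n\ge 2r+1$ be integers, let $Q\subseteq\mathbb R^N$ be open (the states, in coordinates $q=(q^i)$) and $K\subseteq\mathbb R^M$ a set (the control values; e.g. the closure of a bounded open set with smooth boundary). Jets of order $n$ of curves in $Q$ have coordinates $(t,q_{(0)},\dots,q_{(n)})$ with $t\in\mathbb R$, $q_{(0)}\in Q$, $q_{(\beta)}\in\mathbb R^N$; $j^n_t(q)$ is the jet of a curve $q$ at $t$. A function of jets has actual order at most $k$ if it does not depend on $q_{(\beta)}$ for $\beta>k$. Smooth means $C^\infty$; on closed intervals and rectangles derivatives at the boundary are one-sided, and a function on $J^n\times K$ is smooth if it is the restriction of a smooth function defined near $J^n\times K$. A *defining triple* $(\mathscr K,L,C)$ consists of: * a smooth $L=L(t,q_{(0)},\dots,q_{(n)},u)$ on $J^n\times K$ of actual order at most $r$; * a smooth function $C$ of jets, of actual order at most $r-1$, which vanishes at all jets with $t=0$. Its total derivative is $\frac{dC}{dt}=\frac{\partial C}{\partial t}+\sum_{\delta<n}\sum_i\frac{\partial C}{\partial q^i_{(\delta)}}q^i_{(\delta+1)}$;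 * a set $\mathscr K$ of pairs $U=(u,\sigma)$, where $u:[0,T]\to K$ is smooth and $\sigma$ is a jet of order $2r-1$ at $t=0$, such that for each $U\in\mathscr K$ there is exactly one smooth curve $\gamma^{(U)}=q:[0,T]\to Q$ with $j^{2r-1}_{0}(q)=\sigma$ which solves the Euler–Lagrange equations of the time-dependent Lagrangian $L^{u(\cdot)}(t,\cdot)=L(t,\cdot,u(t))$, $$\sum_{\beta=0}^{r}(-1)^\beta\frac{d^\beta}{dt^\beta}\Big(\frac{\partial L}{\partial q^i_{(\beta)}}\big(j^n_t(q),u(t)\big)\Big)=0,\qquad 1\le i\le N,\ t\in[0,T].$$ The curves $\gamma^{(U)}$, $U\in\mathscr K$, are the *$\mathscr K$-controlled curves*. Such a curve $\gamma_o$ is a *solution of the generalised Mayer problem* if $C(j^n_T(\gamma_o))\le C(j^n_T(\gamma))$ for every $\mathscr K$-controlled curve $\gamma$. A *$\mathscr K$-controlled variation* is a smooth homotopy $F:[0,T]\times[0,1]\to Q$, together with a smooth map $u:[0,T]\times[0,1]\to K$, such that for each $s\in[0,1]$ the pair $U(s)$ formed by $u(\cdot,s)$ and $\sigma(s)=j^{2r-1}_0(F(\cdot,s))$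 is in $\mathscr K$ and $F(\cdot,s)=\gamma^{(U(s))}$; its endpoints are $F(\cdot,0)$ and $F(\cdot,1)$. **Auxiliary functions.** For a control curve $u$ and a curve $q$, for $0\le\beta\le r-1$, $1\le i\le N$ and a controlled Lagrangian $\Lambda$ put $$p^{\Lambda,i}_\beta(t)=\sum_{\delta=\beta+1}^{r}(-1)^{\delta-\beta-1}\frac{d^{\,\delta-\beta-1}}{dt^{\,\delta-\beta-1}}\Big(\frac{\partial \Lambda}{\partial q^i_{(\delta)}}\big(j^n_t(q),u(t)\big)\Big).$$ Let ${\bf h}^i_\beta(t)=Ae^t+Be^{-t}$ with ${\bf h}^i_\beta(0)=q^i_{(\beta)}(0)$ and $\dot{\bf h}^i_\beta(0)=-p^{L,i}_\beta(0)$. Let ${\bf h}'^i_\beta$ and ${\bf h}''^i_\beta$ be the linear combinations of $e^{\pm\frac{\pi}{2T}t}$, $\cos\frac{\pi t}{2T}$, $\sin\frac{\pi t}{2T}$ which vanish together with their first derivatives at $t=0$ and whose first and second derivatives at $t=T$ are, respectively, $\big(q^i_{(\beta)}(T),\,p^{L+\frac{dC}{dt},i}_\beta(T)\big)$ for ${\bf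 h}'^i_\beta$ and $\big({\bf h}^i_\beta(T),\,\dot{\bf h}^i_\beta(T)\big)$ for ${\bf h}''^i_\beta$. Write ${\bf h}_{\beta(k)}$ for $k$-th derivatives in $t$. For a $\mathscr K$-controlled variation $F$ with control curves $u(\cdot,s)$, all these functions are formed for each $s$ from $q=F(\cdot,s)$ and $u(\cdot,s)$; put $$\mu(t,s)=-\int_0^t\Big(L+\tfrac12\sum_{i,\beta}\big(({\bf h}^i_{\beta(1)})^2-({\bf h}'^i_{\beta(2)})^2-({\bf h}''^i_{\beta(2)})^2\big)+\sum_{i,\beta}\big(\tfrac12({\bf h}^i_\beta)^2+\tfrac{\pi^4}{32T^4}({\bf h}'^i_\beta)^2+\tfrac{\pi^4}{32T^4}({\bf h}''^i_\beta)^2\big)\Big)\Big|_{(\tau,s)}d\tau,$$ where $L$ is evaluated at $(j^n_\tau(F(\cdot,s)),u(\tau,s))$, and $$\mu'(t,s)=\mu(t,s)+\sum_{\beta=0}^{r-1}\sum_{i=1}^N\int_0^s\Big({\bf h}'^i_{\beta(3)}\frac{\partial{\bf h}'^i_\beta}{\partial s}+{\bf h}''^i_{\beta(3)}\frac{\partial{\bf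 h}''^i_\beta}{\partial s}\Big)\Big|_{(t,v)}dv.$$ For a jet $j$ let $\mathscr P_j(w)=-L(j,w)$, $w\in K$, and let $Y^a=\partial u^a/\partial s$. **Theorem (Generalised Principle of Minimal Labour).** Let $\gamma_o$ be a $\mathscr K$-controlled curve. If $\gamma_o$ is a solution of the generalised Mayer problem of $(\mathscr K,L,C)$, then every $\mathscr K$-controlled variation $F$ with $F(\cdot,0)=\gamma_o$ satisfies $$\int_0^T\bigg(\int_0^1\Big(\sum_{a=1}^M Y^a\,\frac{\partial\mathscr P_{j^n_t(F(\cdot,s))}}{\partial u^a}\bigg|_{u(t,s)}-\frac{\partial^2\mu'}{\partial t\,\partial s}\bigg|_{(t,s)}\Big)ds\bigg)dt\le 0.$$ Conversely, if any two $\mathscr K$-controlled curves are the endpoints $F(\cdot,0)$, $F(\cdot,1)$ of some $\mathscr K$-controlled variation, and if this inequality holds for every $\mathscr K$-controlled variation $F$ with $F(\cdot,0)=\gamma_o$, then $\gamma_o$ is a solution of the generalised Mayer problem. -/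

import Mathlib

open Set
open scoped ContDiff

noncomputable section

namespace MinimalLabour

/-! ### Jets, total derivatives, actual orders -/

/-- Canonical coordinates `(t, q_(0), ..., q_(n))` on the `n`-th jet space of curves in `ℝ^N`. -/
abbrev Jet (N n : ℕ) : Type := ℝ × (Fin (n + 1) → Fin N → ℝ)

/-- The part of the `n`-th jet space lying over the open set `Q` of positions. -/
def jetsOver {N : ℕ} (n : ℕ) (Q : Set (Fin N → ℝ)) : Set (Jet N n) := {j | j.2 0 ∈ Q}

/-- The `n`-th jet at time `t` of a curve `q` defined on `[0, T]`
(one-sided derivatives at the end points). -/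
def jet {N : ℕ} (n : ℕ) (T : ℝ) (q : ℝ → Fin N → ℝ) (t : ℝ) : Jet N n :=
  (t, fun k => iteratedDerivWithin k q (Icc 0 T) t)

/-- The values `q_(0)(0), ..., q_(2r-1)(0)`, i.e. the jet of order `2r - 1` at time `0`. -/
def initialJet {N : ℕ} (r : ℕ) (T : ℝ) (q : ℝ → Fin N → ℝ) : Fin (2 * r) → Fin N → ℝ :=
  fun k => iteratedDerivWithin k q (Icc 0 T) 0

/-- The partial derivative `∂f/∂q^i_(β)`. -/
def pderivQ {N n : ℕ} (f : Jet N n → ℝ) (β : Fin (n + 1)) (i : Fin N) (j : Jet N n) : ℝ :=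
  fderiv ℝ f j ((0 : ℝ), (Pi.single β (Pi.single i (1 : ℝ)) : Fin (n + 1) → Fin N → ℝ))

/-- The total derivative `df/dt = ∂f/∂t + ∑ ∂f/∂q^i_(δ) q^i_(δ+1)` of a function of jets
(used for functions which do not depend on the coordinates of top order `n`). -/
def totalDeriv {N n : ℕ} (f : Jet N n → ℝ) (j : Jet N n) : ℝ :=
  fderiv ℝ f j ((1 : ℝ), (0 : Fin (n + 1) → Fin N → ℝ)) +
    ∑ δ : Fin n, ∑ i : Fin N, pderivQ f δ.castSucc i j * j.2 δ.succ i

/-- Over `Q`, the function `f` does not depend on the coordinates `q_(β)` with `β ≥ k + 1`. -/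
def HasActualOrder {N n : ℕ} (Q : Set (Fin N → ℝ)) (f : Jet N n → ℝ) (k : ℕ) : Prop :=
  ∀ j ∈ jetsOver n Q, ∀ j' ∈ jetsOver n Q, j.1 = j'.1 →
    (∀ β : Fin (n + 1), (β : ℕ) ≤ k → j.2 β = j'.2 β) → f j = f j'

/-! ### Controlled Lagrangians -/

/-- The left hand side at time `t` of the `i`-th Euler-Lagrange equation of the time dependent
Lagrangian `L^{u(·)}(t, q, ..., q_(r)) = L(t, q, ..., q_(r), u(t))`, along the curve `q`:
`∑_{0 ≤ β ≤ r} (-1)^β (d/dt)^β (∂L^{u(·)}/∂q^i_(β))`. -/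
def eulerLagrange {N M n : ℕ} (r : ℕ) (T : ℝ) (L : Jet N n → (Fin M → ℝ) → ℝ)
    (u : ℝ → Fin M → ℝ) (q : ℝ → Fin N → ℝ) (i : Fin N) (t : ℝ) : ℝ :=
  ∑ β ∈ Finset.univ.filter (fun β : Fin (n + 1) => (β : ℕ) ≤ r),
    (-1 : ℝ) ^ (β : ℕ) *
      iteratedDerivWithin β (fun τ => pderivQ (fun j => L j (u τ)) β i (jet n T q τ)) (Icc 0 T) t

/-- The sum of `(-1)^ε (d/dt)^ε (∂L^{u(·)}/∂q^i_(δ))` over all `1 ≤ δ ≤ r` and `0 ≤ ε ≤ δ`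
such that `δ - ε - 1 = β`, evaluated along the curve `q` at time `t`. -/
def momentum {N M n : ℕ} (r : ℕ) (T : ℝ) (L : Jet N n → (Fin M → ℝ) → ℝ)
    (u : ℝ → Fin M → ℝ) (q : ℝ → Fin N → ℝ) (β : ℕ) (i : Fin N) (t : ℝ) : ℝ :=
  ∑ δ ∈ Finset.univ.filter (fun δ : Fin (n + 1) => β < (δ : ℕ) ∧ (δ : ℕ) ≤ r),
    (-1 : ℝ) ^ ((δ : ℕ) - β - 1) *
      iteratedDerivWithin ((δ : ℕ) - β - 1)
        (fun τ => pderivQ (fun j => L j (u τ)) δ i (jet n T q τ)) (Icc 0 T) t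

/-- `q` is a smooth curve `[0, T] → Q` solving the controlled Euler-Lagrange equations. -/
def IsSolution {N M n : ℕ} (r : ℕ) (T : ℝ) (Q : Set (Fin N → ℝ))
    (L : Jet N n → (Fin M → ℝ) → ℝ) (u : ℝ → Fin M → ℝ) (q : ℝ → Fin N → ℝ) : Prop :=
  ContDiffOn ℝ ∞ q (Icc 0 T) ∧ MapsTo q (Icc 0 T) Q ∧
    ∀ i : Fin N, ∀ t ∈ Icc 0 T, eulerLagrange r T L u q i t = 0

/-- A defining triple `(𝒦, L, C)` on the time interval `[0, T]`, with states in an open set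
`Q ⊆ ℝ^N`, control values in `K ⊆ ℝ^M` and jets of order `n`. The set of control parameters `𝒦`
consists of pairs `(u, σ)` of a curve `u` on `[0, T]` and a jet `σ` of order `2r - 1` at `t = 0`. -/
structure DefiningTriple (N M n r : ℕ) (T : ℝ) where
  T_pos : 0 < T
  one_le_r : 1 ≤ r
  order_le : 2 * r + 1 ≤ n
  Q : Set (Fin N → ℝ)
  isOpen_Q : IsOpen Q
  K : Set (Fin M → ℝ)
  L : Jet N n → (Fin M → ℝ) → ℝ
  /-- `L` is smooth (in a neighbourhood of each point of its domain `J^n × K`). -/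
  smooth_L : ∀ j ∈ jetsOver n Q, ∀ w ∈ K, ContDiffAt ℝ ∞ (Function.uncurry L) (j, w)
  order_L : ∀ w ∈ K, HasActualOrder Q (fun j => L j w) r
  C : Jet N n → ℝ
  smooth_C : ContDiffOn ℝ ∞ C (jetsOver n Q)
  /-- `C` has actual order at most `r - 1`, so that `dC/dt` has actual order at most `r`. -/
  order_C : HasActualOrder Q C (r - 1)
  C_zero : ∀ j ∈ jetsOver n Q, j.1 = 0 → C j = 0
  𝒦 : Set ((Icc (0 : ℝ) T → Fin M → ℝ) × (Fin (2 * r) → Fin N → ℝ))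
  controls : ∀ (u : ℝ → Fin M → ℝ) (σ : Fin (2 * r) → Fin N → ℝ),
    ((Icc (0 : ℝ) T).domRestrict u, σ) ∈ 𝒦 → ContDiffOn ℝ ∞ u (Icc 0 T) ∧ MapsTo u (Icc 0 T) K
  /-- For each `(u, σ) ∈ 𝒦` the initial value problem has exactly one solution on `[0, T]`. -/
  wellPosed : ∀ (u : ℝ → Fin M → ℝ) (σ : Fin (2 * r) → Fin N → ℝ),
    ((Icc (0 : ℝ) T).domRestrict u, σ) ∈ 𝒦 →
      ∃ q : ℝ → Fin N → ℝ, IsSolution r T Q L u q ∧ initialJet r T q = σ ∧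
        ∀ p : ℝ → Fin N → ℝ, IsSolution r T Q L u p → initialJet r T p = σ → EqOn p q (Icc 0 T)

namespace DefiningTriple

variable {N M n r : ℕ} {T : ℝ} (D : DefiningTriple N M n r T)

/-- `q` is the curve determined by the pair `U = (u, σ)` of `𝒦` with `σ` the initial jet of `q`. -/
def IsControlledBy (u : ℝ → Fin M → ℝ) (q : ℝ → Fin N → ℝ) : Prop :=
  ((Icc (0 : ℝ) T).domRestrict u, initialJet r T q) ∈ D.𝒦 ∧ IsSolution r T D.Q D.L u q

/-- `q` is a `𝒦`-controlled curve. -/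
def IsControlledCurve (q : ℝ → Fin N → ℝ) : Prop := ∃ u, D.IsControlledBy u q

/-- The terminal cost of a curve. -/
def cost (q : ℝ → Fin N → ℝ) : ℝ := D.C (jet n T q T)

/-- `q` is a solution of the generalised Mayer problem. -/
def IsOptimal (q : ℝ → Fin N → ℝ) : Prop :=
  D.IsControlledCurve q ∧ ∀ p, D.IsControlledCurve p → D.cost q ≤ D.cost p

/-- `F(t, s)` is a `𝒦`-controlled variation, with control curves `u(t, s)`: a smooth homotopy
`[0, T] × [0, 1] → Q` such that each `F(·, s)` is the controlled curve of a pair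
`U(s) = (u(·, s), σ(s))` of `𝒦` which depends smoothly on `s` (here `σ(s)` is the initial jet
of `F(·, s)`). -/
def IsControlledVariation (u : ℝ × ℝ → Fin M → ℝ) (F : ℝ × ℝ → Fin N → ℝ) : Prop :=
  ContDiffOn ℝ ∞ u (Icc (0 : ℝ) T ×ˢ Icc (0 : ℝ) 1) ∧
  ContDiffOn ℝ ∞ F (Icc (0 : ℝ) T ×ˢ Icc (0 : ℝ) 1) ∧
  ∀ s ∈ Icc (0 : ℝ) 1, D.IsControlledBy (fun t => u (t, s)) (fun t => F (t, s))

/-- `F(·, 0)` is the curve `q` on `[0, T]`. -/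
def StartsAt (_D : DefiningTriple N M n r T) (F : ℝ × ℝ → Fin N → ℝ) (q : ℝ → Fin N → ℝ) : Prop :=
  ∀ t ∈ Icc (0 : ℝ) T, F (t, 0) = q t

/-- `F(·, 1)` is the curve `q` on `[0, T]`. -/
def EndsAt (_D : DefiningTriple N M n r T) (F : ℝ × ℝ → Fin N → ℝ) (q : ℝ → Fin N → ℝ) : Prop :=
  ∀ t ∈ Icc (0 : ℝ) T, F (t, 1) = q t

end DefiningTriple

/-! ### The functions `h`, `h'`, `h''` -/

/-- `A e^t + B e^{-t}` with `A + B = x` and `A - B = y`. -/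
def expFun (x y t : ℝ) : ℝ := (x + y) / 2 * Real.exp t + (x - y) / 2 * Real.exp (-t)

/-- The frequency `π / (2T)`. -/
def freq (T : ℝ) : ℝ := Real.pi / (2 * T)

/-- The matrix sending the coefficients `(A, B, C, D)` of
`f = A e^{ωt} + B e^{-ωt} + C cos ωt + D sin ωt`, `ω = π / (2T)`, to
`(f(0), f_(1)(0), f_(1)(T), f_(2)(T))`. -/
def boundaryMatrix (T : ℝ) : Matrix (Fin 4) (Fin 4) ℝ :=
  !![1, 1, 1, 0;
     freq T, -freq T, 0, freq T;
     freq T * Real.exp (Real.pi / 2), -(freq T * Real.exp (-(Real.pi / 2))), -freq T, 0;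
     freq T ^ 2 * Real.exp (Real.pi / 2), freq T ^ 2 * Real.exp (-(Real.pi / 2)), 0, -freq T ^ 2]

/-- The coefficients `(A, B, C, D)` with boundary data `(0, 0, x, y)`. -/
def boundaryCoeff (T x y : ℝ) : Fin 4 → ℝ :=
  Matrix.mulVec (boundaryMatrix T)⁻¹ ![0, 0, x, y]

/-- The function `A e^{ωt} + B e^{-ωt} + C cos ωt + D sin ωt` with boundary data `(0, 0, x, y)`. -/
def boundaryFun (T x y t : ℝ) : ℝ :=
  boundaryCoeff T x y 0 * Real.exp (freq T * t) +
    boundaryCoeff T x y 1 * Real.exp (-(freq T * t)) +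
    boundaryCoeff T x y 2 * Real.cos (freq T * t) +
    boundaryCoeff T x y 3 * Real.sin (freq T * t)

namespace DefiningTriple

variable {N M n r : ℕ} {T : ℝ} (D : DefiningTriple N M n r T)

/-- The function `h^i_β` of a curve `q` with control `u`. -/
def hZero (u : ℝ → Fin M → ℝ) (q : ℝ → Fin N → ℝ) (β : ℕ) (i : Fin N) (t : ℝ) : ℝ :=
  expFun (iteratedDerivWithin β q (Icc 0 T) 0 i) (-momentum r T D.L u q β i 0) t

/-- The function `h'^i_β` of a curve `q` with control `u`. -/
def hPrime (u : ℝ → Fin M → ℝ) (q : ℝ → Fin N → ℝ) (β : ℕ) (i : Fin N) (t : ℝ) : ℝ :=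
  boundaryFun T (iteratedDerivWithin β q (Icc 0 T) T i)
    (momentum r T (fun j w => D.L j w + totalDeriv D.C j) u q β i T) t

/-- The function `h''^i_β` of a curve `q` with control `u`. -/
def hSecond (u : ℝ → Fin M → ℝ) (q : ℝ → Fin N → ℝ) (β : ℕ) (i : Fin N) (t : ℝ) : ℝ :=
  boundaryFun T (D.hZero u q β i T) (deriv (D.hZero u q β i) T) t

/-! ### The functions `μ`, `μ'` and the double integral -/

/-- The function `μ(t, s)` of a variation `F` with control curves `u(·, s)`. -/
def mu (u : ℝ × ℝ → Fin M → ℝ) (F : ℝ × ℝ → Fin N → ℝ) (t s : ℝ) : ℝ :=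
  let us : ℝ → Fin M → ℝ := fun τ => u (τ, s);
  let qs : ℝ → Fin N → ℝ := fun τ => F (τ, s);
  -(∫ τ in (0 : ℝ)..t,
    (D.L (jet n T qs τ) (us τ) +
      1 / 2 * ∑ β ∈ Finset.range r, ∑ i : Fin N,
        (deriv (D.hZero us qs β i) τ ^ 2 - iteratedDeriv 2 (D.hPrime us qs β i) τ ^ 2 -
          iteratedDeriv 2 (D.hSecond us qs β i) τ ^ 2) +
      ∑ β ∈ Finset.range r, ∑ i : Fin N,
        (1 / 2 * D.hZero us qs β i τ ^ 2 +
          Real.pi ^ 4 / (32 * T ^ 4) * D.hPrime us qs β i τ ^ 2 +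
          Real.pi ^ 4 / (32 * T ^ 4) * D.hSecond us qs β i τ ^ 2)))

/-- The function `μ'(t, s)`: `μ(t, s)` plus the integrals over `v ∈ [0, s]` of
`h'_(3) ∂h'/∂s + h''_(3) ∂h''/∂s` at `(t, v)`, summed over `0 ≤ β ≤ r - 1` and `1 ≤ i ≤ N`. -/
def muPrime (u : ℝ × ℝ → Fin M → ℝ) (F : ℝ × ℝ → Fin N → ℝ) (t s : ℝ) : ℝ :=
  D.mu u F t s +
    ∑ β ∈ Finset.range r, ∑ i : Fin N, ∫ v in (0 : ℝ)..s,
      (iteratedDeriv 3 (D.hPrime (fun τ => u (τ, v)) (fun τ => F (τ, v)) β i) t *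
          derivWithin (fun s' => D.hPrime (fun τ => u (τ, s')) (fun τ => F (τ, s')) β i t)
            (Icc 0 1) v +
        iteratedDeriv 3 (D.hSecond (fun τ => u (τ, v)) (fun τ => F (τ, v)) β i) t *
          derivWithin (fun s' => D.hSecond (fun τ => u (τ, s')) (fun τ => F (τ, s')) β i t)
            (Icc 0 1) v)

/-- The function `𝒫_j(w) = -L(j, w)` of the control values. -/
def pontryagin (j : Jet N n) (w : Fin M → ℝ) : ℝ := -D.L j w

/-- The double integral of `Y^a ∂𝒫/∂u^a - ∂²μ'/∂t∂s`, where `Y^a = ∂u^a/∂s`. -/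
def labour (u : ℝ × ℝ → Fin M → ℝ) (F : ℝ × ℝ → Fin N → ℝ) : ℝ :=
  ∫ t in (0 : ℝ)..T, ∫ s in (0 : ℝ)..1,
    ((∑ a : Fin M,
        derivWithin (fun s' => u (t, s') a) (Icc 0 1) s *
          fderiv ℝ (D.pontryagin (jet n T (fun τ => F (τ, s)) t)) (u (t, s)) (Pi.single a 1)) -
      derivWithin (fun t' => derivWithin (fun s' => D.muPrime u F t' s') (Icc 0 1) s)
        (Icc 0 T) t)

end DefiningTriple

end MinimalLabour

end

/-! Everything rests on one identity: the labour of a controlled variation equals `C` at the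
terminal jet of `F(·,0)` minus `C` at the terminal jet of `F(·,1)` (`labour_eq`). Granted this,
non-positive labour says exactly that the end curve costs at least as much as the initial one, and
both implications follow at once.

The identity holds because the labour integrand is an exact time derivative `∂W/∂t`
(`labour_integrand_eq`) of the potential `W = ∑ (p_β ∂_s q_(β) + h_(1) ∂_s h - h'_(2) ∂_s h'_(1) -
h''_(2) ∂_s h''_(1))`, where `p_β` are the momenta of `L`. By the Euler-Lagrange equations the time
derivative of `∑ p_β ∂_s q_(β)` is the part of `∂_s L` coming from the jet variables; the part
coming from the control is what the term `Y^a ∂𝒫/∂u^a` removes from `-∂²μ/∂t∂s`. The quadratic terms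
of `μ` and the correction in `μ'` are designed to supply the derivatives of the other three
products: `h` solves `h_(2) = h`, while `h'` and `h''` solve `f_(4) = ω⁴ f` with `ω = π/(2T)`.

The boundary data determine `W` at the ends. At `t = 0`, `h` starts at `q_(β)` with slope `-p_β`,
and `h'`, `h''` start with slope zero, so `W = 0` (`labourPotential_zero`). At `t = T` the terms of
`h` and `h''` cancel, and `h'` contributes minus the momentum of `L + dC/dt` times `∂_s q_(β)`. That
momentum exceeds the one of `L` by `∂C/∂q_(β)` (`totalMomentumFam_eq`), so `W = -∂_s C`
(`labourPotential_right`). Integrating `∂W/∂t` over the rectangle, first in `t` and then in `s`,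
gives the identity. -/

noncomputable section

namespace MinimalLabour

/-! ### Calculus on the rectangle `[0, T] × [0, 1]` -/

section Rectangle

/-- The parameter domain `[0, T] × [0, 1]` of the variations. -/
def rect (T : ℝ) : Set (ℝ × ℝ) := Icc 0 T ×ˢ Icc 0 1

/-- The first partial derivative on the rectangle. -/
def Dt {E : Type*} [NormedAddCommGroup E] [NormedSpace ℝ E] (T : ℝ) (f : ℝ × ℝ → E) :
    ℝ × ℝ → E :=
  fun p => fderivWithin ℝ f (rect T) p (1, 0)

/-- The second partial derivative on the rectangle. -/
def Ds {E : Type*} [NormedAddCommGroup E] [NormedSpace ℝ E] (T : ℝ) (f : ℝ × ℝ → E) :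
    ℝ × ℝ → E :=
  fun p => fderivWithin ℝ f (rect T) p (0, 1)

variable {E : Type*} [NormedAddCommGroup E] [NormedSpace ℝ E] {T : ℝ}

theorem uniqueDiffOn_rect (hT : 0 < T) : UniqueDiffOn ℝ (rect T) :=
  (uniqueDiffOn_Icc hT).prod (uniqueDiffOn_Icc one_pos)

theorem contDiffOn_Dt (hT : 0 < T) {f : ℝ × ℝ → E} (hf : ContDiffOn ℝ ∞ f (rect T)) :
    ContDiffOn ℝ ∞ (Dt T f) (rect T) :=
  (hf.fderivWithin (uniqueDiffOn_rect hT) (by simp)).clm_apply contDiffOn_const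

theorem contDiffOn_Ds (hT : 0 < T) {f : ℝ × ℝ → E} (hf : ContDiffOn ℝ ∞ f (rect T)) :
    ContDiffOn ℝ ∞ (Ds T f) (rect T) :=
  (hf.fderivWithin (uniqueDiffOn_rect hT) (by simp)).clm_apply contDiffOn_const

theorem contDiffOn_iterate_Dt (hT : 0 < T) {f : ℝ × ℝ → E} (hf : ContDiffOn ℝ ∞ f (rect T))
    (k : ℕ) : ContDiffOn ℝ ∞ ((Dt T)^[k] f) (rect T) := by
  induction k with
  | zero => exact hf
  | succ k ih => rw [Function.iterate_succ_apply']; exact contDiffOn_Dt hT ih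

theorem differentiableWithinAt_of_contDiffOn {f : ℝ × ℝ → E} (hf : ContDiffOn ℝ ∞ f (rect T))
    {p : ℝ × ℝ} (hp : p ∈ rect T) : DifferentiableWithinAt ℝ f (rect T) p :=
  hf.differentiableOn (by simp) p hp

theorem hasDerivWithinAt_fst {f : ℝ × ℝ → E} (hf : ContDiffOn ℝ ∞ f (rect T)) {t s : ℝ}
    (ht : t ∈ Icc 0 T) (hs : s ∈ Icc (0 : ℝ) 1) :
    HasDerivWithinAt (fun τ => f (τ, s)) (Dt T f (t, s)) (Icc 0 T) t := by
  have h := (differentiableWithinAt_of_contDiffOn hf (p := (t, s)) ⟨ht, hs⟩).hasFDerivWithinAt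
  have hm : MapsTo (fun τ : ℝ => (τ, s)) (Icc 0 T) (rect T) := fun τ hτ => ⟨hτ, hs⟩
  exact h.comp_hasDerivWithinAt t
    (((hasDerivAt_id t).prodMk (hasDerivAt_const t s)).hasDerivWithinAt (s := Icc 0 T)) hm

theorem hasDerivWithinAt_snd {f : ℝ × ℝ → E} (hf : ContDiffOn ℝ ∞ f (rect T)) {t s : ℝ}
    (ht : t ∈ Icc 0 T) (hs : s ∈ Icc (0 : ℝ) 1) :
    HasDerivWithinAt (fun v => f (t, v)) (Ds T f (t, s)) (Icc 0 1) s := by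
  have h := (differentiableWithinAt_of_contDiffOn hf (p := (t, s)) ⟨ht, hs⟩).hasFDerivWithinAt
  have hm : MapsTo (fun v : ℝ => (t, v)) (Icc 0 1) (rect T) := fun v hv => ⟨ht, hv⟩
  exact h.comp_hasDerivWithinAt s
    (((hasDerivAt_const s t).prodMk (hasDerivAt_id s)).hasDerivWithinAt (s := Icc (0 : ℝ) 1)) hm

theorem Dt_eq_of_hasDerivWithinAt (hT : 0 < T) {f : ℝ × ℝ → E} (hf : ContDiffOn ℝ ∞ f (rect T))
    {t s : ℝ} (ht : t ∈ Icc 0 T) (hs : s ∈ Icc (0 : ℝ) 1) {e : E}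
    (h : HasDerivWithinAt (fun τ => f (τ, s)) e (Icc 0 T) t) : Dt T f (t, s) = e :=
  (uniqueDiffOn_Icc hT t ht).eq_deriv _ (hasDerivWithinAt_fst hf ht hs) h

theorem Ds_eq_of_hasDerivWithinAt {f : ℝ × ℝ → E} (hf : ContDiffOn ℝ ∞ f (rect T))
    {t s : ℝ} (ht : t ∈ Icc 0 T) (hs : s ∈ Icc (0 : ℝ) 1) {e : E}
    (h : HasDerivWithinAt (fun v => f (t, v)) e (Icc 0 1) s) : Ds T f (t, s) = e :=
  (uniqueDiffOn_Icc one_pos s hs).eq_deriv _ (hasDerivWithinAt_snd hf ht hs) h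

theorem Dt_congr {f g : ℝ × ℝ → E} (h : EqOn f g (rect T)) : EqOn (Dt T f) (Dt T g) (rect T) :=
  fun p hp => by simp only [Dt, fderivWithin_congr h (h hp)]

theorem Ds_congr {f g : ℝ × ℝ → E} (h : EqOn f g (rect T)) : EqOn (Ds T f) (Ds T g) (rect T) :=
  fun p hp => by simp only [Ds, fderivWithin_congr h (h hp)]

theorem closure_interior_rect (hT : 0 < T) : closure (interior (rect T)) = rect T := by
  rw [rect, interior_prod_eq, closure_prod_eq, closure_interior_Icc hT.ne,
    closure_interior_Icc zero_ne_one]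

/-- Symmetry of the second derivative within a set holds at its points in the closure of the
interior. The rectangle is the closure of its interior, so the partial derivatives commute up to the
boundary. -/
theorem Dt_Ds_comm (hT : 0 < T) {f : ℝ × ℝ → E} (hf : ContDiffOn ℝ ∞ f (rect T)) {p : ℝ × ℝ}
    (hp : p ∈ rect T) : Dt T (Ds T f) p = Ds T (Dt T f) p := by
  have hd : DifferentiableWithinAt ℝ (fderivWithin ℝ f (rect T)) (rect T) p :=
    (hf.fderivWithin (m := ∞) (uniqueDiffOn_rect hT) (by simp)).differentiableOn (by simp) p hp
  have hsymm : IsSymmSndFDerivWithinAt ℝ f (rect T) p :=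
      (hf p hp).isSymmSndFDerivWithinAt (by simpa using ENat.LEInfty.out) (uniqueDiffOn_rect hT)
      (by rwa [closure_interior_rect hT]) hp
  have key : ∀ v w : ℝ × ℝ, fderivWithin ℝ (fun q => fderivWithin ℝ f (rect T) q v) (rect T) p w =
      fderivWithin ℝ (fderivWithin ℝ f (rect T)) (rect T) p w v := by
    intro v w
    rw [fderivWithin_clm_apply (uniqueDiffOn_rect hT p hp) hd (differentiableWithinAt_const v)]
    simp
  have h1 := key (0, 1) (1, 0)
  have h2 := key (1, 0) (0, 1)
  exact h1.trans ((hsymm.eq _ _).trans h2.symm)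

/-- Jets are defined slice by slice; this rewrites them through iterates of `Dt`, which are jointly
smooth in `(t, s)`. -/
theorem iteratedDerivWithin_fst (hT : 0 < T) {f : ℝ × ℝ → E} (hf : ContDiffOn ℝ ∞ f (rect T))
    (k : ℕ) {t s : ℝ} (ht : t ∈ Icc 0 T) (hs : s ∈ Icc (0 : ℝ) 1) :
    iteratedDerivWithin k (fun τ => f (τ, s)) (Icc 0 T) t = ((Dt T)^[k] f) (t, s) := by
  induction k generalizing t with
  | zero => simp
  | succ k ih =>
    rw [iteratedDerivWithin_succ, derivWithin_congr (fun τ hτ => ih hτ) (ih ht),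
      Function.iterate_succ_apply']
    exact (hasDerivWithinAt_fst (contDiffOn_iterate_Dt hT hf k) ht hs).derivWithin
      (uniqueDiffOn_Icc hT t ht)

/-- A continuous function on the rectangle has a continuous extension to the plane. -/
theorem exists_continuous_extension {X : Type*} [TopologicalSpace X] {T : ℝ} (hT : 0 < T)
    {g : ℝ × ℝ → X} (hg : ContinuousOn g (rect T)) :
    ∃ G : ℝ × ℝ → X, Continuous G ∧ EqOn G g (rect T) := by
  refine ⟨fun p => g (projIcc 0 T hT.le p.1, projIcc (0 : ℝ) 1 zero_le_one p.2), ?_, ?_⟩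
  · refine hg.comp_continuous ?_ fun p => ⟨Subtype.prop _, Subtype.prop _⟩
    exact (continuous_subtype_val.comp (continuous_projIcc.comp continuous_fst)).prodMk
      (continuous_subtype_val.comp (continuous_projIcc.comp continuous_snd))
  · rintro ⟨t, s⟩ ⟨ht, hs⟩
    simp only [projIcc_of_mem hT.le ht, projIcc_of_mem zero_le_one hs]

theorem integral_interval_swap {g : ℝ × ℝ → ℝ} {a b c d : ℝ}
    (hg : ContinuousOn g (uIcc a b ×ˢ uIcc c d)) :
    ∫ t in a..b, ∫ s in c..d, g (t, s) = ∫ s in c..d, ∫ t in a..b, g (t, s) :=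
  MeasureTheory.intervalIntegral_intervalIntegral_swap
    ((hg.integrableOn_compact (isCompact_uIcc.prod isCompact_uIcc)).mono_set
      (prod_mono uIoc_subset_uIcc uIoc_subset_uIcc))

/-- The one-sided fundamental theorem of calculus on a closed interval. -/
theorem hasDerivWithinAt_primitive {b : ℝ} (hb : 0 < b) {f : ℝ → ℝ} (hf : ContinuousOn f (Icc 0 b))
    {x : ℝ} (hx : x ∈ Icc 0 b) :
    HasDerivWithinAt (fun y => ∫ v in (0 : ℝ)..y, f v) (f x) (Icc 0 b) x := by
  set G : ℝ → ℝ := fun v => f (projIcc 0 b hb.le v) with hGdef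
  have hG : Continuous G := hf.comp_continuous
    (continuous_subtype_val.comp continuous_projIcc) fun v => Subtype.prop _
  have hGf : ∀ v ∈ Icc 0 b, G v = f v := fun v hv => by simp only [hGdef, projIcc_of_mem hb.le hv]
  have hint : ∀ y ∈ Icc 0 b, ∫ v in (0 : ℝ)..y, f v = ∫ v in (0 : ℝ)..y, G v := by
    intro y hy
    refine intervalIntegral.integral_congr fun v hv => (hGf v ?_).symm
    rw [uIcc_of_le hy.1] at hv
    exact ⟨hv.1, hv.2.trans hy.2⟩
  rw [← hGf x hx]
  exact ((hG.integral_hasStrictDerivAt 0 x).hasDerivAt.hasDerivWithinAt).congr hint (hint x hx)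

theorem integral_eq_sub_of_hasDerivWithinAt {b : ℝ} (hb : 0 < b) {f f' : ℝ → ℝ}
    (h : ∀ x ∈ Icc 0 b, HasDerivWithinAt f (f' x) (Icc 0 b) x) (hf' : ContinuousOn f' (Icc 0 b)) :
    ∫ x in (0 : ℝ)..b, f' x = f b - f 0 := by
  refine intervalIntegral.integral_eq_sub_of_hasDerivAt_of_le hb.le
    (fun x hx => (h x hx).continuousWithinAt)
    (fun x hx => (h x (Ioo_subset_Icc_self hx)).hasDerivAt (Icc_mem_nhds hx.1 hx.2)) ?_
  exact ContinuousOn.intervalIntegrable (by rwa [uIcc_of_le hb.le])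

/-- Differentiation under the integral sign, up to the boundary. -/
theorem hasDerivWithinAt_parametric_integral (hT : 0 < T) {g : ℝ × ℝ → ℝ}
    (hg : ContDiffOn ℝ ∞ g (rect T)) {t s : ℝ} (ht : t ∈ Icc 0 T) (hs : s ∈ Icc (0 : ℝ) 1) :
    HasDerivWithinAt (fun v => ∫ τ in (0 : ℝ)..t, g (τ, v))
      (∫ τ in (0 : ℝ)..t, Ds T g (τ, s)) (Icc 0 1) s := by
  have hDs : ContinuousOn (Ds T g) (rect T) := (contDiffOn_Ds hT hg).continuousOn
  obtain ⟨G, hG, hGg⟩ := exists_continuous_extension hT hDs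
  have hmem : ∀ τ ∈ uIcc 0 t, τ ∈ Icc 0 T := by
    intro τ hτ
    rw [uIcc_of_le ht.1] at hτ
    exact ⟨hτ.1, hτ.2.trans ht.2⟩
  have hslice : ∀ v ∈ Icc (0 : ℝ) 1, IntervalIntegrable (fun τ => g (τ, v)) MeasureTheory.volume 0 t := by
    intro v hv
    refine ContinuousOn.intervalIntegrable fun τ hτ => ?_
    exact ((hasDerivWithinAt_fst hg (hmem τ hτ) hv).continuousWithinAt).mono hmem
  -- By Fubini the parametric integral is a primitive in `v` of a continuous function. Using the
  -- extension `G` instead of `Ds T g` makes that function continuous on the whole line, so the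
  -- two-sided fundamental theorem applies even at the end points.
  have key : ∀ v ∈ Icc (0 : ℝ) 1, ∫ τ in (0 : ℝ)..t, g (τ, v) =
      (∫ τ in (0 : ℝ)..t, g (τ, 0)) + ∫ w in (0 : ℝ)..v, ∫ τ in (0 : ℝ)..t, G (τ, w) := by
    intro v hv
    rw [← integral_interval_swap hG.continuousOn, ← sub_eq_iff_eq_add',
      ← intervalIntegral.integral_sub (hslice v hv) (hslice 0 (by simp))]
    refine intervalIntegral.integral_congr fun τ hτ => ?_
    have hsub : Icc 0 v ⊆ Icc (0 : ℝ) 1 := Icc_subset_Icc_right hv.2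
    rcases hv.1.eq_or_lt with h0 | h0
    · simp [← h0]
    · refine (integral_eq_sub_of_hasDerivWithinAt h0 (f := fun v => g (τ, v)) (fun w hw => ?_)
        (by fun_prop)).symm
      rw [hGg (show (τ, w) ∈ rect T from ⟨hmem τ hτ, hsub hw⟩)]
      exact (hasDerivWithinAt_snd hg (hmem τ hτ) (hsub hw)).mono hsub
  have hval : ∫ τ in (0 : ℝ)..t, Ds T g (τ, s) = ∫ τ in (0 : ℝ)..t, G (τ, s) :=
    intervalIntegral.integral_congr fun τ hτ => (hGg ⟨hmem τ hτ, hs⟩).symm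
  rw [hval]
  have hH : Continuous fun w => ∫ τ in (0 : ℝ)..t, G (τ, w) :=
    intervalIntegral.continuous_parametric_intervalIntegral_of_continuous'
      (f := fun w τ => G (τ, w)) (hG.comp (continuous_snd.prodMk continuous_fst)) 0 t
  exact (((hH.integral_hasStrictDerivAt 0 s).hasDerivAt.const_add _).hasDerivWithinAt).congr key
    (key s hs)

end Rectangle

/-! ### The functions `A e^t + B e^{-t}` and `A e^{ωt} + B e^{-ωt} + C cos ωt + D sin ωt` -/

section AuxiliaryFunctions

theorem expFun_zero (x y : ℝ) : expFun x y 0 = x := by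
  simp only [expFun, neg_zero, Real.exp_zero]; ring

theorem hasDerivAt_expFun (x y t : ℝ) : HasDerivAt (expFun x y) (expFun y x t) t := by
  have h := ((Real.hasDerivAt_exp t).const_mul ((x + y) / 2)).add
    ((hasDerivAt_neg t).exp.const_mul ((x - y) / 2))
  refine h.congr_deriv ?_
  simp only [expFun]; ring

theorem contDiffOn_expFun {T : ℝ} {x y : ℝ × ℝ → ℝ} (hx : ContDiffOn ℝ ∞ x (rect T))
    (hy : ContDiffOn ℝ ∞ y (rect T)) :
    ContDiffOn ℝ ∞ (fun p => expFun (x p) (y p) p.1) (rect T) := by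
  unfold expFun
  have h1 : ContDiffOn ℝ ∞ (fun p : ℝ × ℝ => Real.exp p.1) (rect T) := by fun_prop
  have h2 : ContDiffOn ℝ ∞ (fun p : ℝ × ℝ => Real.exp (-p.1)) (rect T) := by fun_prop
  exact (((hx.add hy).div_const 2).mul h1).add (((hx.sub hy).div_const 2).mul h2)

/-- A kernel vector is shown to vanish, after cancelling the powers of `ω` from the last three rows;
the argument uses only `e > 1` and `e e' = 1` for `e = exp (π/2)`, `e' = exp (-π/2)`. -/
theorem det_boundaryMatrix_ne_zero {T : ℝ} (hT : 0 < T) : (boundaryMatrix T).det ≠ 0 := by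
  have hω : freq T ≠ 0 := (div_pos Real.pi_pos (by linarith)).ne'
  have he : 1 < Real.exp (Real.pi / 2) := Real.one_lt_exp_iff.2 (by positivity)
  have hinv : Real.exp (Real.pi / 2) * Real.exp (-(Real.pi / 2)) = 1 := by
    rw [← Real.exp_add]; simp
  intro hdet
  obtain ⟨v, hv, hmul⟩ := Matrix.exists_mulVec_eq_zero_iff.2 hdet
  have h0 := congrFun hmul 0
  have h1 := congrFun hmul 1
  have h2 := congrFun hmul 2
  have h3 := congrFun hmul 3
  simp only [boundaryMatrix, Matrix.mulVec, dotProduct, Fin.sum_univ_four, Matrix.of_apply,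
    Matrix.cons_val, Pi.zero_apply] at h0 h1 h2 h3
  set e := Real.exp (Real.pi / 2)
  set e' := Real.exp (-(Real.pi / 2))
  have k1 : v 0 - v 1 + v 3 = 0 := mul_left_cancel₀ hω (by linear_combination h1)
  have k2 : v 0 * e - v 1 * e' - v 2 = 0 := mul_left_cancel₀ hω (by linear_combination h2)
  have k3 : v 0 * e + v 1 * e' - v 3 = 0 :=
    mul_left_cancel₀ (pow_ne_zero 2 hω) (by linear_combination h3)
  have z0 : v 0 = 0 := by
    -- In the sum of the four equations the unknowns `v 1`, `v 2`, `v 3` cancel.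
    have : v 0 * (e + 1) = 0 := by linear_combination (h0 + k1 + k2 + k3) / 2
    rcases mul_eq_zero.1 this with h | h
    · exact h
    · linarith
  have z1 : v 1 = 0 := by
    -- With `v 0 = 0`, the sum of `h0` and `k2` reads `v 1 * (1 - e') = 0`; multiply by `e`.
    have : v 1 * (e - 1) = 0 := by
      linear_combination e * (k2 + h0) - (e + e * e) * z0 + v 1 * hinv
    rcases mul_eq_zero.1 this with h | h
    · exact h
    · linarith
  have z2 : v 2 = 0 := by rw [z0, z1] at k2; linarith
  have z3 : v 3 = 0 := by rw [z0, z1] at k1; linarith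
  apply hv
  funext i
  fin_cases i <;> assumption

/-- The `k`-th derivative of `boundaryFun`. -/
def boundaryDeriv (k : ℕ) (T x y t : ℝ) : ℝ :=
  boundaryCoeff T x y 0 * (freq T ^ k * Real.exp (freq T * t)) +
    boundaryCoeff T x y 1 * ((-freq T) ^ k * Real.exp (-(freq T * t))) +
    boundaryCoeff T x y 2 * (freq T ^ k * Real.cos (freq T * t + k * (Real.pi / 2))) +
    boundaryCoeff T x y 3 * (freq T ^ k * Real.sin (freq T * t + k * (Real.pi / 2)))

theorem boundaryDeriv_zero (T x y : ℝ) : boundaryDeriv 0 T x y = boundaryFun T x y := by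
  funext t; simp [boundaryDeriv, boundaryFun]

/-- The phase `k π/2` in `boundaryDeriv` absorbs the signs and the alternation of sine and cosine,
so one formula serves all orders. -/
theorem hasDerivAt_boundaryDeriv (k : ℕ) (T x y t : ℝ) :
    HasDerivAt (boundaryDeriv k T x y) (boundaryDeriv (k + 1) T x y t) t := by
  have hl : HasDerivAt (fun t => freq T * t) (freq T) t := by
    simpa using (hasDerivAt_id t).const_mul (freq T)
  have hl' := hl.add_const ((k : ℝ) * (Real.pi / 2))
  have h := (((hl.exp.const_mul (freq T ^ k)).const_mul (boundaryCoeff T x y 0)).add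
    ((hl.neg.exp.const_mul ((-freq T) ^ k)).const_mul (boundaryCoeff T x y 1))).add
    ((hl'.cos.const_mul (freq T ^ k)).const_mul (boundaryCoeff T x y 2)) |>.add
    ((hl'.sin.const_mul (freq T ^ k)).const_mul (boundaryCoeff T x y 3))
  refine h.congr_deriv ?_
  have e : freq T * t + ((k + 1 : ℕ) : ℝ) * (Real.pi / 2) =
      freq T * t + k * (Real.pi / 2) + Real.pi / 2 := by push_cast; ring
  simp only [boundaryDeriv, e, Real.cos_add_pi_div_two, Real.sin_add_pi_div_two, Pi.neg_apply]
  ring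

theorem iteratedDeriv_boundaryFun (k : ℕ) (T x y : ℝ) :
    iteratedDeriv k (boundaryFun T x y) = boundaryDeriv k T x y := by
  induction k with
  | zero => rw [iteratedDeriv_zero, boundaryDeriv_zero]
  | succ k ih =>
    rw [iteratedDeriv_succ, ih]
    exact funext fun t => (hasDerivAt_boundaryDeriv k T x y t).deriv

/-- All four basis functions are eigenfunctions of the fourth derivative with eigenvalue `ω⁴`. This
lets the correction term in `μ'` cancel the undifferentiated squares in `μ`. -/
theorem boundaryDeriv_four (T x y t : ℝ) :
    boundaryDeriv 4 T x y t = freq T ^ 4 * boundaryDeriv 0 T x y t := by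
  have e : freq T * t + ((4 : ℕ) : ℝ) * (Real.pi / 2) = freq T * t + 2 * Real.pi := by
    push_cast; ring
  simp only [boundaryDeriv, e, Real.cos_add_two_pi, Real.sin_add_two_pi]
  simp
  ring

theorem boundaryMatrix_mulVec_boundaryCoeff {T : ℝ} (hT : 0 < T) (x y : ℝ) :
    (boundaryMatrix T).mulVec (boundaryCoeff T x y) = ![0, 0, x, y] := by
  rw [boundaryCoeff, Matrix.mulVec_mulVec,
    Matrix.mul_nonsing_inv _ (isUnit_iff_ne_zero.2 (det_boundaryMatrix_ne_zero hT)),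
    Matrix.one_mulVec]

theorem freq_mul_self {T : ℝ} (hT : 0 < T) : freq T * T = Real.pi / 2 := by
  have := hT.ne'
  simp only [freq]; field_simp

theorem boundaryDeriv_one_zero {T : ℝ} (hT : 0 < T) (x y : ℝ) : boundaryDeriv 1 T x y 0 = 0 := by
  have h := congrFun (boundaryMatrix_mulVec_boundaryCoeff hT x y) 1
  simp only [boundaryMatrix, Matrix.mulVec, dotProduct, Fin.sum_univ_four, Matrix.of_apply,
    Matrix.cons_val] at h
  simp [boundaryDeriv]
  linear_combination h

theorem boundaryDeriv_one_right {T : ℝ} (hT : 0 < T) (x y : ℝ) :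
    boundaryDeriv 1 T x y T = x := by
  have h := congrFun (boundaryMatrix_mulVec_boundaryCoeff hT x y) 2
  simp only [boundaryMatrix, Matrix.mulVec, dotProduct, Fin.sum_univ_four, Matrix.of_apply,
    Matrix.cons_val] at h
  simp [boundaryDeriv, freq_mul_self hT]
  linear_combination h

theorem boundaryDeriv_two_right {T : ℝ} (hT : 0 < T) (x y : ℝ) :
    boundaryDeriv 2 T x y T = y := by
  have h := congrFun (boundaryMatrix_mulVec_boundaryCoeff hT x y) 3
  simp only [boundaryMatrix, Matrix.mulVec, dotProduct, Fin.sum_univ_four, Matrix.of_apply,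
    Matrix.cons_val] at h
  have e : Real.pi / 2 + 2 * (Real.pi / 2) = Real.pi / 2 + Real.pi := by ring
  simp [boundaryDeriv, freq_mul_self hT, e]
  linear_combination h

theorem contDiffOn_boundaryDeriv {T : ℝ} (k : ℕ) {x y : ℝ × ℝ → ℝ}
    (hx : ContDiffOn ℝ ∞ x (rect T)) (hy : ContDiffOn ℝ ∞ y (rect T)) :
    ContDiffOn ℝ ∞ (fun p => boundaryDeriv k T (x p) (y p) p.1) (rect T) := by
  -- The coefficients are linear in the boundary data `(x, y)`.
  have hc : ∀ i, ContDiffOn ℝ ∞ (fun p => boundaryCoeff T (x p) (y p) i) (rect T) := by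
    intro i
    simp only [boundaryCoeff, Matrix.mulVec, dotProduct, Fin.sum_univ_four, Matrix.cons_val]
    simp only [mul_zero, zero_add]
    exact (contDiffOn_const.mul hx).add (contDiffOn_const.mul hy)
  unfold boundaryDeriv
  refine (((hc 0).mul ?_).add ((hc 1).mul ?_)).add ((hc 2).mul ?_) |>.add ((hc 3).mul ?_) <;>
    fun_prop

end AuxiliaryFunctions

/-! ### Jets along a homotopy -/

section Jets

variable {N M n : ℕ} {T : ℝ}

/-- The jets of the curves of a homotopy, as a function on the rectangle. -/
def jetMap (n : ℕ) (T : ℝ) (F : ℝ × ℝ → Fin N → ℝ) (p : ℝ × ℝ) : Jet N n :=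
  jet n T (fun τ => F (τ, p.2)) p.1

theorem jetMap_eq (hT : 0 < T) {F : ℝ × ℝ → Fin N → ℝ} (hF : ContDiffOn ℝ ∞ F (rect T)) :
    EqOn (jetMap n T F) (fun p => (p.1, fun k => ((Dt T)^[(k : ℕ)] F) p) : ℝ × ℝ → Jet N n)
      (rect T) := by
  rintro ⟨t, s⟩ ⟨ht, hs⟩
  simp only [jetMap, jet, iteratedDerivWithin_fst hT hF _ ht hs]

theorem contDiffOn_jetMap (hT : 0 < T) {F : ℝ × ℝ → Fin N → ℝ} (hF : ContDiffOn ℝ ∞ F (rect T)) :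
    ContDiffOn ℝ ∞ (jetMap n T F) (rect T) :=
  (contDiffOn_fst.prodMk (contDiffOn_pi.2 fun k : Fin (n + 1) => contDiffOn_iterate_Dt hT hF (k : ℕ))).congr
    (jetMap_eq hT hF)

/-- The last coordinate here is the derivative of order `n + 1`, which is not part of the jet; hence
this vector agrees with `totalVec` only up to the top-order direction. -/
theorem Dt_jetMap (hT : 0 < T) {F : ℝ × ℝ → Fin N → ℝ} (hF : ContDiffOn ℝ ∞ F (rect T))
    {p : ℝ × ℝ} (hp : p ∈ rect T) :
    Dt T (jetMap n T F) p = ((1, fun k => ((Dt T)^[(k : ℕ) + 1] F) p) : Jet N n) := by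
  obtain ⟨t, s⟩ := p
  obtain ⟨ht, hs⟩ := hp
  refine Dt_eq_of_hasDerivWithinAt hT (contDiffOn_jetMap hT hF) ht hs ?_
  have h : HasDerivWithinAt (fun τ => ((τ, fun k => ((Dt T)^[(k : ℕ)] F) (τ, s)) : Jet N n))
      (1, fun k => ((Dt T)^[(k : ℕ) + 1] F) (t, s)) (Icc 0 T) t := by
    refine (hasDerivWithinAt_id _ _).prodMk (hasDerivWithinAt_pi.2 fun k => ?_)
    rw [Function.iterate_succ_apply']
    exact hasDerivWithinAt_fst (contDiffOn_iterate_Dt hT hF k) ht hs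
  exact h.congr (fun τ hτ => jetMap_eq hT hF (show (τ, s) ∈ rect T from ⟨hτ, hs⟩))
    (jetMap_eq hT hF (show (t, s) ∈ rect T from ⟨ht, hs⟩))

theorem Ds_jetMap (hT : 0 < T) {F : ℝ × ℝ → Fin N → ℝ} (hF : ContDiffOn ℝ ∞ F (rect T))
    {p : ℝ × ℝ} (hp : p ∈ rect T) :
    Ds T (jetMap n T F) p = ((0, fun k => Ds T ((Dt T)^[(k : ℕ)] F) p) : Jet N n) := by
  obtain ⟨t, s⟩ := p
  obtain ⟨ht, hs⟩ := hp
  refine Ds_eq_of_hasDerivWithinAt (contDiffOn_jetMap hT hF) ht hs ?_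
  have h : HasDerivWithinAt (fun v => ((t, fun k => ((Dt T)^[(k : ℕ)] F) (t, v)) : Jet N n))
      (0, fun k => Ds T ((Dt T)^[(k : ℕ)] F) (t, s)) (Icc 0 1) s :=
    (hasDerivWithinAt_const _ _ _).prodMk (hasDerivWithinAt_pi.2 fun k =>
      hasDerivWithinAt_snd (contDiffOn_iterate_Dt hT hF k) ht hs)
  exact h.congr (fun v hv => jetMap_eq hT hF (show (t, v) ∈ rect T from ⟨ht, hv⟩))
    (jetMap_eq hT hF (show (t, s) ∈ rect T from ⟨ht, hs⟩))

theorem jetMap_mem_jetsOver {Q : Set (Fin N → ℝ)} {F : ℝ × ℝ → Fin N → ℝ}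
    (hF : MapsTo F (rect T) Q) : MapsTo (jetMap n T F) (rect T) (jetsOver n Q) := by
  rintro ⟨t, s⟩ hp
  simpa [jetsOver, jetMap, jet] using hF hp

/-! ### Chain rules on the rectangle -/

section Composition

variable {E G : Type*} [NormedAddCommGroup E] [NormedSpace ℝ E] [NormedAddCommGroup G]
  [NormedSpace ℝ G]

theorem Dt_comp (hT : 0 < T) {c : E → G} {g : ℝ × ℝ → E} {p : ℝ × ℝ} (hp : p ∈ rect T)
    (hc : DifferentiableAt ℝ c (g p)) (hg : ContDiffOn ℝ ∞ g (rect T)) :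
    Dt T (fun q => c (g q)) p = fderiv ℝ c (g p) (Dt T g p) := by
  simp only [Dt]
  have := fderiv_comp_fderivWithin p hc (differentiableWithinAt_of_contDiffOn hg hp)
    (uniqueDiffOn_rect hT p hp)
  exact congrArg (fun ℓ : ℝ × ℝ →L[ℝ] G => ℓ (1, 0)) this

theorem Ds_comp (hT : 0 < T) {c : E → G} {g : ℝ × ℝ → E} {p : ℝ × ℝ} (hp : p ∈ rect T)
    (hc : DifferentiableAt ℝ c (g p)) (hg : ContDiffOn ℝ ∞ g (rect T)) :
    Ds T (fun q => c (g q)) p = fderiv ℝ c (g p) (Ds T g p) := by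
  simp only [Ds]
  have := fderiv_comp_fderivWithin p hc (differentiableWithinAt_of_contDiffOn hg hp)
    (uniqueDiffOn_rect hT p hp)
  exact congrArg (fun ℓ : ℝ × ℝ →L[ℝ] G => ℓ (0, 1)) this

end Composition

/-! ### Functions of jets -/

/-- The coordinate vector field `∂/∂q^i_(β)`. -/
def coordVec (β : Fin (n + 1)) (i : Fin N) : Jet N n :=
  ((0 : ℝ), (Pi.single β (Pi.single i (1 : ℝ)) : Fin (n + 1) → Fin N → ℝ))

theorem apply_zero_prod (ℓ : Jet N n →L[ℝ] ℝ) (y : Fin (n + 1) → Fin N → ℝ) :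
    ℓ (0, y) = ∑ k, ∑ i, ℓ (coordVec k i) * y k i := by
  have hy : ((0 : ℝ), y) = ∑ k, ∑ i, y k i • (coordVec k i : Jet N n) := by
    refine Prod.ext ?_ ?_
    · simp [coordVec, Prod.fst_sum]
    · funext k i
      simp [coordVec, Prod.snd_sum, Finset.sum_apply, Pi.single_apply, ite_apply]
  rw [hy, map_sum]
  refine Finset.sum_congr rfl fun k _ => ?_
  rw [map_sum]
  exact Finset.sum_congr rfl fun i _ => by rw [map_smul, smul_eq_mul, mul_comm]

theorem isOpen_jetsOver {Q : Set (Fin N → ℝ)} (hQ : IsOpen Q) : IsOpen (jetsOver n Q) :=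
  hQ.preimage ((continuous_apply 0).comp continuous_snd)

/-- A function of actual order at most `k` has no derivative in the directions of order `> k`. -/
theorem HasActualOrder.fderiv_apply_eq_zero {Q : Set (Fin N → ℝ)} {f : Jet N n → ℝ} {k : ℕ}
    (hf : HasActualOrder Q f k) {j : Jet N n} (hj : j ∈ jetsOver n Q)
    (hd : DifferentiableAt ℝ f j) {y : Fin (n + 1) → Fin N → ℝ}
    (hy : ∀ β : Fin (n + 1), (β : ℕ) ≤ k → y β = 0) : fderiv ℝ f j (0, y) = 0 := by
  rw [← hd.lineDeriv_eq_fderiv, lineDeriv]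
  have : (fun t : ℝ => f (j + t • ((0 : ℝ), y))) = fun _ => f j := by
    funext t
    -- The line from `j` in direction `(0, y)` changes only coordinates of order above `k`. Since `0
    -- ≤ k`, the position is fixed and the line stays over `Q`.
    refine hf _ ?_ _ hj (by simp) fun β hβ => by simp [hy β hβ]
    simpa [jetsOver, hy 0 (by simp)] using hj
  rw [this, deriv_const]

theorem HasActualOrder.pderivQ_eq_zero {Q : Set (Fin N → ℝ)} {f : Jet N n → ℝ} {k : ℕ}
    (hf : HasActualOrder Q f k) {j : Jet N n} (hj : j ∈ jetsOver n Q)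
    (hd : DifferentiableAt ℝ f j) {β : Fin (n + 1)} (hβ : k < β) (i : Fin N) :
    pderivQ f β i j = 0 :=
  hf.fderiv_apply_eq_zero hj hd fun γ hγ => by
    rw [Pi.single_eq_of_ne]
    rintro rfl
    omega

/-- The shift `q_(k) ↦ q_(k+1)`, with zero in the top order. -/
def jetShift (N n : ℕ) : (Fin (n + 1) → Fin N → ℝ) →L[ℝ] (Fin (n + 1) → Fin N → ℝ) :=
  ContinuousLinearMap.pi fun k =>
    if h : (k : ℕ) + 1 < n + 1 then
      ContinuousLinearMap.proj (R := ℝ) (φ := fun _ : Fin (n + 1) => Fin N → ℝ) ⟨k + 1, h⟩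
    else 0

theorem jetShift_castSucc (y : Fin (n + 1) → Fin N → ℝ) (k : Fin n) :
    jetShift N n y k.castSucc = y k.succ := by
  simp [jetShift]
  rfl

theorem jetShift_last (y : Fin (n + 1) → Fin N → ℝ) : jetShift N n y (Fin.last n) = 0 := by
  simp [jetShift]

theorem jetShift_single (k : Fin n) (z : Fin N → ℝ) :
    jetShift N n (Pi.single k.succ z) = Pi.single k.castSucc z := by
  funext l
  induction l using Fin.lastCases with
  | last => rw [jetShift_last, Pi.single_eq_of_ne (Fin.castSucc_lt_last k).ne']
  | cast l =>
    rw [jetShift_castSucc]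
    by_cases h : l = k
    · subst h; simp
    · rw [Pi.single_eq_of_ne (by simpa using h), Pi.single_eq_of_ne (by simpa using h)]

/-- The vector field of the total derivative. -/
def totalVec (j : Jet N n) : Jet N n := (1, jetShift N n j.2)

/-- Writing the total derivative as one Fréchet derivative along a vector field makes the product
rule and the symmetry of second derivatives available. -/
theorem totalDeriv_eq (f : Jet N n → ℝ) (j : Jet N n) :
    totalDeriv f j = fderiv ℝ f j (totalVec j) := by
  have h : totalVec j = ((1 : ℝ), (0 : Fin (n + 1) → Fin N → ℝ)) + (0, jetShift N n j.2) := by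
    simp [totalVec]
  rw [h, map_add, apply_zero_prod, Fin.sum_univ_castSucc, totalDeriv, jetShift_last]
  simp [jetShift_castSucc, pderivQ, coordVec]

theorem hasFDerivAt_totalVec (j : Jet N n) :
    HasFDerivAt (totalVec (N := N) (n := n))
      ((0 : Jet N n →L[ℝ] ℝ).prod ((jetShift N n).comp (ContinuousLinearMap.snd ℝ ℝ _))) j :=
  (hasFDerivAt_const 1 j).prodMk ((jetShift N n).hasFDerivAt.comp j hasFDerivAt_snd)

theorem contDiffAt_totalVec (j : Jet N n) : ContDiffAt ℝ ∞ (totalVec (N := N) (n := n)) j :=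
  contDiffAt_const.prodMk ((jetShift N n).contDiff.contDiffAt.comp j contDiffAt_snd)

theorem contDiffAt_totalDeriv {f : Jet N n → ℝ} {j : Jet N n} (hf : ContDiffAt ℝ ∞ f j) :
    ContDiffAt ℝ ∞ (totalDeriv f) j := by
  rw [funext (totalDeriv_eq f)]
  exact (hf.fderiv_right (m := ∞) (by simp)).clm_apply (contDiffAt_totalVec j)

theorem contDiffAt_pderivQ {f : Jet N n → ℝ} {j : Jet N n} (hf : ContDiffAt ℝ ∞ f j)
    (β : Fin (n + 1)) (i : Fin N) : ContDiffAt ℝ ∞ (pderivQ f β i) j :=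
  (hf.fderiv_right (m := ∞) (by simp)).clm_apply contDiffAt_const

theorem fderiv_fderiv_apply {f : Jet N n → ℝ} {j : Jet N n} (hf : ContDiffAt ℝ ∞ f j)
    (v w : Jet N n) :
    fderiv ℝ (fun j' => fderiv ℝ f j' v) j w = fderiv ℝ (fderiv ℝ f) j w v := by
  have hd : DifferentiableAt ℝ (fderiv ℝ f) j :=
    (hf.fderiv_right (m := ∞) (by simp)).differentiableAt (by simp)
  rw [fderiv_clm_apply hd (differentiableAt_const v)]
  simp

/-- Product rule for `j ↦ Df(j)(totalVec j)`: the last term appears because the linear part of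
`totalVec` sends the direction `q_(k+1)` to `q_(k)`. -/
theorem pderivQ_totalDeriv {f : Jet N n → ℝ} {j : Jet N n} (hf : ContDiffAt ℝ ∞ f j)
    (k : Fin n) (i : Fin N) :
    pderivQ (totalDeriv f) k.succ i j =
      fderiv ℝ (fderiv ℝ f) j (coordVec k.succ i) (totalVec j) + pderivQ f k.castSucc i j := by
  have hd : DifferentiableAt ℝ (fderiv ℝ f) j :=
    (hf.fderiv_right (m := ∞) (by simp)).differentiableAt (by simp)
  have h := (hd.hasFDerivAt.clm_apply (hasFDerivAt_totalVec j)).fderiv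
  rw [funext (totalDeriv_eq f)]
  unfold pderivQ
  rw [h]
  simp [coordVec, jetShift_single, add_comm]

theorem isSymm_fderiv_fderiv {f : Jet N n → ℝ} {j : Jet N n} (hf : ContDiffAt ℝ ∞ f j)
    (v w : Jet N n) : fderiv ℝ (fderiv ℝ f) j v w = fderiv ℝ (fderiv ℝ f) j w v :=
  (hf.isSymmSndFDerivAt (by simpa using ENat.LEInfty.out)).eq v w

/-- If `f` does not depend on the coordinates of top order, then
`d/dt (∂f/∂q^i_(β)) = ∂/∂q^i_(β) (df/dt) - ∂f/∂q^i_(β-1)` along curves. -/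
theorem Dt_pderivQ_jetMap (hT : 0 < T) {Q : Set (Fin N → ℝ)} (hQ : IsOpen Q)
    {F : ℝ × ℝ → Fin N → ℝ} (hF : ContDiffOn ℝ ∞ F (rect T)) (hFQ : MapsTo F (rect T) Q)
    {f : Jet N n → ℝ} (hf : ContDiffOn ℝ ∞ f (jetsOver n Q)) {k : ℕ} (hk : k < n)
    (hord : HasActualOrder Q f k) (β : Fin n) (i : Fin N) {p : ℝ × ℝ} (hp : p ∈ rect T) :
    pderivQ (totalDeriv f) β.succ i (jetMap n T F p) =
      Dt T (fun q => pderivQ f β.succ i (jetMap n T F q)) p +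
        pderivQ f β.castSucc i (jetMap n T F p) := by
  have hfat : ∀ j ∈ jetsOver n Q, ContDiffAt ℝ ∞ f j := fun j hj =>
    hf.contDiffAt ((isOpen_jetsOver hQ).mem_nhds hj)
  have hJ := jetMap_mem_jetsOver (n := n) hFQ hp
  have hc := hfat _ hJ
  rw [pderivQ_totalDeriv hc,
    Dt_comp hT hp ((contDiffAt_pderivQ hc _ i).differentiableAt (by simp)) (contDiffOn_jetMap hT hF)]
  congr 1
  set j := jetMap n T F p with hj
  have hvec : Dt T (jetMap n T F) p =
      totalVec j + (0, Pi.single (Fin.last n) (((Dt T)^[n + 1] F) p)) := by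
    rw [Dt_jetMap hT hF hp, hj, jetMap_eq hT hF hp]
    refine Prod.ext (by simp [totalVec]) (funext fun l => ?_)
    induction l using Fin.lastCases with
    | last => simp [totalVec, jetShift_last]
    | cast l =>
      simp only [totalVec, Prod.mk_add_mk, Pi.add_apply, jetShift_castSucc]
      rw [Pi.single_eq_of_ne (Fin.castSucc_lt_last l).ne]
      simp
  -- The top-order derivative of `f` vanishes on a whole neighbourhood of `j`, hence so do its mixed
  -- second derivatives. The discrepancy between `Dt T (jetMap n T F)` and `totalVec` is therefore
  -- invisible.
  have htop : ∀ z : Fin N → ℝ,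
      fderiv ℝ (fderiv ℝ f) j (coordVec β.succ i) (0, Pi.single (Fin.last n) z) = 0 := by
    intro z
    rw [← fderiv_fderiv_apply hc]
    have hz : (fun j' => fderiv ℝ f j' (0, Pi.single (Fin.last n) z)) =ᶠ[nhds j] fun _ => 0 := by
      filter_upwards [(isOpen_jetsOver hQ).mem_nhds hJ] with j' hj'
      refine hord.fderiv_apply_eq_zero hj' ((hfat j' hj').differentiableAt (by simp)) fun γ hγ => ?_
      rw [Pi.single_eq_of_ne]
      rintro rfl
      simp at hγ
      omega
    rw [hz.fderiv_eq]
    simp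
  have hfun : pderivQ f β.succ i = fun j' => fderiv ℝ f j' (coordVec β.succ i) := rfl
  rw [hfun, fderiv_fderiv_apply hc, hvec, isSymm_fderiv_fderiv hc _ (coordVec β.succ i), map_add,
    htop, add_zero]

end Jets

/-! ### Momenta along a homotopy -/

section Momenta

variable {N M n r : ℕ} {T : ℝ}

/-- The alternating sum `∑_{β < δ ≤ r} (-1)^(δ-β-1) (∂/∂t)^(δ-β-1) f_δ`. -/
def ostrogradsky (r : ℕ) (T : ℝ) (f : ℕ → ℝ × ℝ → ℝ) (β : ℕ) (p : ℝ × ℝ) : ℝ :=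
  ∑ δ ∈ Finset.Ioc β r, (-1 : ℝ) ^ (δ - β - 1) * ((Dt T)^[δ - β - 1] (f δ)) p

theorem contDiffOn_ostrogradsky (hT : 0 < T) {f : ℕ → ℝ × ℝ → ℝ}
    (hf : ∀ δ, ContDiffOn ℝ ∞ (f δ) (rect T)) (β : ℕ) :
    ContDiffOn ℝ ∞ (ostrogradsky r T f β) (rect T) :=
  ContDiffOn.sum fun δ _ => contDiffOn_const.mul (contDiffOn_iterate_Dt hT (hf δ) _)

theorem Dt_alternating_sum (hT : 0 < T) {f : ℕ → ℝ × ℝ → ℝ}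
    (hf : ∀ δ, ContDiffOn ℝ ∞ (f δ) (rect T)) (S : Finset ℕ) (e : ℕ → ℕ) {p : ℝ × ℝ}
    (hp : p ∈ rect T) :
    Dt T (fun q => ∑ δ ∈ S, (-1 : ℝ) ^ e δ * ((Dt T)^[e δ] (f δ)) q) p =
      ∑ δ ∈ S, (-1 : ℝ) ^ e δ * ((Dt T)^[e δ + 1] (f δ)) p := by
  obtain ⟨t, s⟩ := p
  obtain ⟨ht, hs⟩ := hp
  refine Dt_eq_of_hasDerivWithinAt hT (ContDiffOn.sum fun δ _ => contDiffOn_const.mul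
    (contDiffOn_iterate_Dt hT (hf δ) _)) ht hs ?_
  refine HasDerivWithinAt.fun_sum fun δ _ => HasDerivWithinAt.const_mul _ ?_
  rw [Function.iterate_succ_apply']
  exact hasDerivWithinAt_fst (contDiffOn_iterate_Dt hT (hf δ) _) ht hs

/-- Splitting off `δ = β + 1` leaves the sum for `β + 1` with one more derivative and the opposite
sign. This downward recursion, started from zero at `r`, replaces the explicit alternating sums from
here on. -/
theorem ostrogradsky_add_Dt (hT : 0 < T) {f : ℕ → ℝ × ℝ → ℝ}
    (hf : ∀ δ, ContDiffOn ℝ ∞ (f δ) (rect T)) {β : ℕ} (hβ : β < r) {p : ℝ × ℝ}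
    (hp : p ∈ rect T) :
    ostrogradsky r T f β p = f (β + 1) p - Dt T (ostrogradsky r T f (β + 1)) p := by
  have hI : Finset.Ioc β r = insert (β + 1) (Finset.Ioc (β + 1) r) := by
    ext x; simp only [Finset.mem_Ioc, Finset.mem_insert]; omega
  have h : Dt T (ostrogradsky r T f (β + 1)) p = _ :=
    Dt_alternating_sum hT hf (Finset.Ioc (β + 1) r) (fun δ => δ - (β + 1) - 1) hp
  rw [h, ostrogradsky, hI, Finset.sum_insert (by simp), sub_eq_add_neg, ← Finset.sum_neg_distrib]
  congr 1
  · simp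
  · refine Finset.sum_congr rfl fun δ hδ => ?_
    have e : δ - β - 1 = δ - (β + 1) - 1 + 1 := by
      have := Finset.mem_Ioc.1 hδ; omega
    rw [e, pow_succ]; ring

theorem ostrogradsky_self (f : ℕ → ℝ × ℝ → ℝ) : ostrogradsky r T f r = 0 := by
  funext p; simp [ostrogradsky]

/-- The same splitting one index lower: the Euler-Lagrange expression is what the recursion would
give at index `-1`. -/
theorem alternating_sum_eq_sub_Dt_ostrogradsky (hT : 0 < T) {f : ℕ → ℝ × ℝ → ℝ}
    (hf : ∀ δ, ContDiffOn ℝ ∞ (f δ) (rect T)) {p : ℝ × ℝ} (hp : p ∈ rect T) :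
    ∑ δ ∈ Finset.range (r + 1), (-1 : ℝ) ^ δ * ((Dt T)^[δ] (f δ)) p =
      f 0 p - Dt T (ostrogradsky r T f 0) p := by
  have hI : Finset.range (r + 1) = insert 0 (Finset.Ioc 0 r) := by
    ext x; simp only [Finset.mem_Ioc, Finset.mem_insert, Finset.mem_range]; omega
  have h : Dt T (ostrogradsky r T f 0) p = _ :=
    Dt_alternating_sum hT hf (Finset.Ioc 0 r) (fun δ => δ - 0 - 1) hp
  rw [h, hI, Finset.sum_insert (by simp), sub_eq_add_neg, ← Finset.sum_neg_distrib]
  congr 1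
  · simp
  · refine Finset.sum_congr rfl fun δ hδ => ?_
    have e : δ = δ - 0 - 1 + 1 := by
      have := Finset.mem_Ioc.1 hδ; omega
    rw [← e]
    nth_rw 1 [e]
    rw [pow_succ]; ring

/-- Downward induction through the recursion: the term `Dt T (c (β + 1))` in `g` is cancelled by the
one from the momentum of order `β + 1`, leaving `c β`. It is applied with `c δ = ∂C/∂q_(δ)`. -/
theorem ostrogradsky_eq_add (hT : 0 < T) {f g c : ℕ → ℝ × ℝ → ℝ}
    (hf : ∀ δ, ContDiffOn ℝ ∞ (f δ) (rect T)) (hg : ∀ δ, ContDiffOn ℝ ∞ (g δ) (rect T))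
    (hc : ∀ δ, ContDiffOn ℝ ∞ (c δ) (rect T)) (hcr : EqOn (c r) 0 (rect T))
    (hgf : ∀ δ < r, ∀ p ∈ rect T, g (δ + 1) p = f (δ + 1) p + Dt T (c (δ + 1)) p + c δ p)
    {β : ℕ} (hβ : β ≤ r) :
    ∀ p ∈ rect T, ostrogradsky r T g β p = ostrogradsky r T f β p + c β p := by
  induction hβ using Nat.decreasingInduction with
  | self => intro p hp; simp [ostrogradsky_self, hcr hp]
  | of_succ β hβ ih =>
    intro p hp
    have hadd : Dt T (ostrogradsky r T g (β + 1)) p =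
        Dt T (ostrogradsky r T f (β + 1)) p + Dt T (c (β + 1)) p := by
      rw [Dt_congr (g := fun q => ostrogradsky r T f (β + 1) q + c (β + 1) q) ih hp]
      obtain ⟨t, s⟩ := p
      exact Dt_eq_of_hasDerivWithinAt hT ((contDiffOn_ostrogradsky hT hf _).add (hc _)) hp.1 hp.2
        ((hasDerivWithinAt_fst (contDiffOn_ostrogradsky hT hf _) hp.1 hp.2).add
          (hasDerivWithinAt_fst (hc _) hp.1 hp.2))
    rw [ostrogradsky_add_Dt hT hg hβ hp, ostrogradsky_add_Dt hT hf hβ hp, hadd, hgf β hβ p hp]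
    ring

/-- The partial derivative `∂Λ/∂q^i_(δ)` of a controlled Lagrangian along a homotopy. -/
def pderivAlong (T : ℝ) (Λ : Jet N n → (Fin M → ℝ) → ℝ) (u : ℝ × ℝ → Fin M → ℝ)
    (F : ℝ × ℝ → Fin N → ℝ) (i : Fin N) (δ : ℕ) (p : ℝ × ℝ) : ℝ :=
  -- The value `0` beyond order `n` allows sums over natural numbers.
  if h : δ < n + 1 then pderivQ (fun j => Λ j (u p)) ⟨δ, h⟩ i (jetMap n T F p) else 0

theorem pderivAlong_of_lt {Λ : Jet N n → (Fin M → ℝ) → ℝ} {u : ℝ × ℝ → Fin M → ℝ}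
    {F : ℝ × ℝ → Fin N → ℝ} {i : Fin N} {δ : ℕ} (h : δ < n + 1) (p : ℝ × ℝ) :
    pderivAlong T Λ u F i δ p = pderivQ (fun j => Λ j (u p)) ⟨δ, h⟩ i (jetMap n T F p) :=
  dif_pos h

theorem fderiv_uncurry_left {E G : Type*} [NormedAddCommGroup E] [NormedSpace ℝ E]
    [NormedAddCommGroup G] [NormedSpace ℝ G] {Λ : E → G → ℝ} {j : E} {w : G}
    (h : DifferentiableAt ℝ (Function.uncurry Λ) (j, w)) (v : E) :
    fderiv ℝ (fun j => Λ j w) j v = fderiv ℝ (Function.uncurry Λ) (j, w) (v, 0) := by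
  have := (HasFDerivAt.comp (f := fun e => (e, w)) j h.hasFDerivAt
    (hasFDerivAt_prodMk_left j w)).fderiv
  exact (congrArg (fun ℓ : E →L[ℝ] ℝ => ℓ v) this).trans (by simp)

theorem fderiv_uncurry_right {E G : Type*} [NormedAddCommGroup E] [NormedSpace ℝ E]
    [NormedAddCommGroup G] [NormedSpace ℝ G] {Λ : E → G → ℝ} {j : E} {w : G}
    (h : DifferentiableAt ℝ (Function.uncurry Λ) (j, w)) (v : G) :
    fderiv ℝ (fun w => Λ j w) w v = fderiv ℝ (Function.uncurry Λ) (j, w) (0, v) := by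
  have := (HasFDerivAt.comp (f := fun e => (j, e)) w h.hasFDerivAt
    (hasFDerivAt_prodMk_right j w)).fderiv
  exact (congrArg (fun ℓ : G →L[ℝ] ℝ => ℓ v) this).trans (by simp)

/-- The regularity of a controlled Lagrangian, a control and a homotopy along which it is
evaluated. -/
structure SmoothAlong (T : ℝ) (Λ : Jet N n → (Fin M → ℝ) → ℝ) (u : ℝ × ℝ → Fin M → ℝ)
    (F : ℝ × ℝ → Fin N → ℝ) : Prop where
  control : ContDiffOn ℝ ∞ u (rect T)
  homotopy : ContDiffOn ℝ ∞ F (rect T)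
  lagrangian : ∀ p ∈ rect T, ContDiffAt ℝ ∞ (Function.uncurry Λ) (jetMap n T F p, u p)

namespace SmoothAlong

variable {Λ : Jet N n → (Fin M → ℝ) → ℝ} {u : ℝ × ℝ → Fin M → ℝ} {F : ℝ × ℝ → Fin N → ℝ}

theorem contDiffOn_jet_control (h : SmoothAlong T Λ u F) (hT : 0 < T) :
    ContDiffOn ℝ ∞ (fun p => (jetMap n T F p, u p)) (rect T) :=
  (contDiffOn_jetMap hT h.homotopy).prodMk h.control

theorem differentiableAt (h : SmoothAlong T Λ u F) {p : ℝ × ℝ} (hp : p ∈ rect T) :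
    DifferentiableAt ℝ (Function.uncurry Λ) (jetMap n T F p, u p) :=
  (h.lagrangian p hp).differentiableAt (by simp)

theorem contDiffOn_comp (h : SmoothAlong T Λ u F) (hT : 0 < T) :
    ContDiffOn ℝ ∞ (fun p => Λ (jetMap n T F p) (u p)) (rect T) := fun p hp =>
  ContDiffAt.comp_contDiffWithinAt (g := Function.uncurry Λ) p (h.lagrangian p hp)
    (h.contDiffOn_jet_control hT p hp)

theorem contDiffOn_pderivAlong (h : SmoothAlong T Λ u F) (hT : 0 < T) (i : Fin N) (δ : ℕ) :
    ContDiffOn ℝ ∞ (pderivAlong T Λ u F i δ) (rect T) := by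
  by_cases hδ : δ < n + 1
  -- The partial derivative with frozen control is read off from the joint derivative of `Λ`, which
  -- varies smoothly with the jet and the control together.
  · have h1 : ContDiffOn ℝ ∞ (fun p => fderiv ℝ (Function.uncurry Λ) (jetMap n T F p, u p)
        (coordVec ⟨δ, hδ⟩ i, 0)) (rect T) := by
      refine ContDiffOn.clm_apply (fun p hp => ?_) contDiffOn_const
      exact ((h.lagrangian p hp).fderiv_right (m := ∞) (by simp)).comp_contDiffWithinAt p
        (h.contDiffOn_jet_control hT p hp)
    refine h1.congr fun p hp => ?_
    rw [pderivAlong_of_lt hδ, pderivQ, fderiv_uncurry_left (h.differentiableAt hp)]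
    rfl
  · exact contDiffOn_const.congr fun p _ => dif_neg hδ

theorem momentum_eq (h : SmoothAlong T Λ u F) (hT : 0 < T) (hr : r ≤ n) (β : ℕ) (i : Fin N)
    {t s : ℝ} (ht : t ∈ Icc 0 T) (hs : s ∈ Icc (0 : ℝ) 1) :
    momentum r T Λ (fun τ => u (τ, s)) (fun τ => F (τ, s)) β i t =
      ostrogradsky r T (pderivAlong T Λ u F i) β (t, s) := by
  refine Finset.sum_nbij (fun δ => (δ : ℕ)) (by simp) (fun a _ b _ hab => Fin.ext hab) ?_ ?_
  · intro δ hδ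
    have := Finset.mem_Ioc.1 hδ
    exact ⟨⟨δ, by omega⟩, by simpa using this, rfl⟩
  · intro δ _
    rw [← iteratedDerivWithin_fst hT (h.contDiffOn_pderivAlong hT i δ) _ ht hs]
    simp only [pderivAlong_of_lt δ.2]
    rfl

theorem eulerLagrange_eq (h : SmoothAlong T Λ u F) (hT : 0 < T) (hr : r ≤ n) (i : Fin N)
    {t s : ℝ} (ht : t ∈ Icc 0 T) (hs : s ∈ Icc (0 : ℝ) 1) :
    eulerLagrange r T Λ (fun τ => u (τ, s)) (fun τ => F (τ, s)) i t =
      pderivAlong T Λ u F i 0 (t, s) -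
        Dt T (ostrogradsky r T (pderivAlong T Λ u F i) 0) (t, s) := by
  rw [← alternating_sum_eq_sub_Dt_ostrogradsky hT (h.contDiffOn_pderivAlong hT i)
    (show (t, s) ∈ rect T from ⟨ht, hs⟩)]
  refine Finset.sum_nbij (fun δ => (δ : ℕ)) (by simp)
    (fun a _ b _ hab => Fin.ext hab) ?_ ?_
  · intro δ hδ
    have := Finset.mem_range.1 hδ
    exact ⟨⟨δ, by omega⟩, by simpa [Nat.lt_succ_iff] using this, rfl⟩
  · intro δ _
    rw [← iteratedDerivWithin_fst hT (h.contDiffOn_pderivAlong hT i δ) _ ht hs]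
    simp only [pderivAlong_of_lt δ.2]
    rfl

/-- The variation `∂q^i_(β)/∂s` of the jet coordinates. -/
theorem hasDerivWithinAt_Ds_iterate (hT : 0 < T) (hF : ContDiffOn ℝ ∞ F (rect T)) (β : ℕ)
    (i : Fin N) {t s : ℝ} (ht : t ∈ Icc 0 T) (hs : s ∈ Icc (0 : ℝ) 1) :
    HasDerivWithinAt (fun τ => Ds T ((Dt T)^[β] F) (τ, s) i)
      (Ds T ((Dt T)^[β + 1] F) (t, s) i) (Icc 0 T) t := by
  have hβ := contDiffOn_iterate_Dt hT hF β
  rw [Function.iterate_succ_apply', ← Dt_Ds_comm hT hβ (show (t, s) ∈ rect T from ⟨ht, hs⟩)]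
  exact hasDerivWithinAt_pi.1 (hasDerivWithinAt_fst (contDiffOn_Ds hT hβ) ht hs) i

/-- Along solutions of the Euler-Lagrange equations,
`d/dt (∑ p_β ∂q_(β)/∂s) = ∑ ∂Λ/∂q_(β) ∂q_(β)/∂s`. -/
theorem hasDerivWithinAt_sum_momentum (h : SmoothAlong T Λ u F) (hT : 0 < T) (hr : r ≤ n)
    (i : Fin N) {t s : ℝ} (ht : t ∈ Icc 0 T) (hs : s ∈ Icc (0 : ℝ) 1)
    (hEL : eulerLagrange r T Λ (fun τ => u (τ, s)) (fun τ => F (τ, s)) i t = 0) :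
    HasDerivWithinAt (fun τ => ∑ β ∈ Finset.range r,
        ostrogradsky r T (pderivAlong T Λ u F i) β (τ, s) * Ds T ((Dt T)^[β] F) (τ, s) i)
      (∑ β ∈ Finset.range (r + 1),
        pderivAlong T Λ u F i β (t, s) * Ds T ((Dt T)^[β] F) (t, s) i) (Icc 0 T) t := by
  have hf := h.contDiffOn_pderivAlong hT i
  set P := ostrogradsky r T (pderivAlong T Λ u F i) with hP
  have hd : HasDerivWithinAt (fun τ => ∑ β ∈ Finset.range r,
        P β (τ, s) * Ds T ((Dt T)^[β] F) (τ, s) i)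
      (∑ β ∈ Finset.range r, (Dt T (P β) (t, s) * Ds T ((Dt T)^[β] F) (t, s) i +
        P β (t, s) * Ds T ((Dt T)^[β + 1] F) (t, s) i)) (Icc 0 T) t :=
    HasDerivWithinAt.fun_sum fun β _ =>
      (hasDerivWithinAt_fst (contDiffOn_ostrogradsky hT hf β) ht hs).mul
        (hasDerivWithinAt_Ds_iterate hT h.homotopy β i ht hs)
  refine hd.congr_deriv ?_
  have h0 : Dt T (P 0) (t, s) = pderivAlong T Λ u F i 0 (t, s) := by
    rw [h.eulerLagrange_eq hT hr i ht hs] at hEL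
    linarith
  have hr0 : Dt T (P r) (t, s) = 0 := by
    rw [hP, ostrogradsky_self]
    have : fderivWithin ℝ (0 : ℝ × ℝ → ℝ) (rect T) (t, s) = 0 := fderivWithin_const_apply (c := (0 : ℝ))
    simp only [Dt, this]; rfl
  -- The recursion turns the product rule into a telescoping part plus the desired terms. The
  -- telescoping sum leaves the `β = 0` term, identified by the Euler-Lagrange equation, and the `β
  -- = r` term, which is zero.
  have hstep : ∀ β ∈ Finset.range r,
      Dt T (P β) (t, s) * Ds T ((Dt T)^[β] F) (t, s) i +
          P β (t, s) * Ds T ((Dt T)^[β + 1] F) (t, s) i =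
        (Dt T (P β) (t, s) * Ds T ((Dt T)^[β] F) (t, s) i -
          Dt T (P (β + 1)) (t, s) * Ds T ((Dt T)^[β + 1] F) (t, s) i) +
        pderivAlong T Λ u F i (β + 1) (t, s) * Ds T ((Dt T)^[β + 1] F) (t, s) i := by
    intro β hβ
    rw [hP, ostrogradsky_add_Dt hT hf (Finset.mem_range.1 hβ) (show (t, s) ∈ rect T from ⟨ht, hs⟩)]
    ring
  rw [Finset.sum_congr rfl hstep, Finset.sum_add_distrib,
    Finset.sum_range_sub' (fun β => Dt T (P β) (t, s) * Ds T ((Dt T)^[β] F) (t, s) i),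
    Finset.sum_range_succ', h0, hr0]
  ring

/-- The derivative of `Λ` in the parameter of the homotopy. -/
theorem Ds_comp_eq (h : SmoothAlong T Λ u F) (hT : 0 < T) {k : ℕ} (hk : k ≤ n) {p : ℝ × ℝ}
    (hp : p ∈ rect T)
    (hord : ∀ i, ∀ δ, k < δ → pderivAlong T Λ u F i δ p = 0) :
    Ds T (fun q => Λ (jetMap n T F q) (u q)) p =
      ∑ i, ∑ δ ∈ Finset.range (k + 1), pderivAlong T Λ u F i δ p * Ds T ((Dt T)^[δ] F) p i +
        ∑ a, Ds T u p a * fderiv ℝ (Λ (jetMap n T F p)) (u p) (Pi.single a 1) := by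
  have hd := h.differentiableAt hp
  have hDs : Ds T (fun q => (jetMap n T F q, u q)) p = (Ds T (jetMap n T F) p, 0) + (0, Ds T u p) := by
    obtain ⟨t, s⟩ := p
    rw [Ds_eq_of_hasDerivWithinAt (h.contDiffOn_jet_control hT) hp.1 hp.2
      ((hasDerivWithinAt_snd (contDiffOn_jetMap hT h.homotopy) hp.1 hp.2).prodMk
        (hasDerivWithinAt_snd h.control hp.1 hp.2))]
    simp
  have h1 : Ds T (fun q => Λ (jetMap n T F q) (u q)) p =
      fderiv ℝ (Function.uncurry Λ) (jetMap n T F p, u p) _ :=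
    Ds_comp hT hp hd (h.contDiffOn_jet_control hT)
  rw [h1, hDs, map_add, ← fderiv_uncurry_left hd, ← fderiv_uncurry_right hd,
    Ds_jetMap hT h.homotopy hp, apply_zero_prod, Finset.sum_comm]
  congr 1
  · refine Finset.sum_congr rfl fun i _ => ?_
    have hsub : Finset.range (k + 1) ⊆ Finset.range (n + 1) :=
      Finset.range_subset_range.2 (by omega)
    rw [Finset.sum_subset hsub fun δ _ hδ => by
      rw [hord i δ (by simpa [Nat.lt_succ_iff] using hδ), zero_mul],
      ← Fin.sum_univ_eq_sum_range (fun δ => pderivAlong T Λ u F i δ p * Ds T ((Dt T)^[δ] F) p i)]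
    refine Finset.sum_congr rfl fun δ _ => ?_
    rw [pderivAlong_of_lt δ.2]
    rfl
  · have hsum : Ds T u p = ∑ a, Ds T u p a • (Pi.single a 1 : Fin M → ℝ) := by
      funext b
      simp [Finset.sum_apply, Pi.single_apply]
    conv_lhs => rw [hsum]
    rw [map_sum]
    exact Finset.sum_congr rfl fun a _ => by rw [map_smul, smul_eq_mul]

end SmoothAlong

end Momenta

/-! ### Families of auxiliary functions with varying boundary data -/

section Families

variable {T : ℝ} {x y : ℝ → ℝ}

theorem contDiffOn_slice {E : Type*} [NormedAddCommGroup E] [NormedSpace ℝ E] {g : ℝ × ℝ → E}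
    (hg : ContDiffOn ℝ ∞ g (rect T)) {a : ℝ} (ha : a ∈ Icc 0 T) :
    ContDiffOn ℝ ∞ (fun s => g (a, s)) (Icc 0 1) :=
  hg.comp (contDiffOn_const.prodMk contDiffOn_id) fun _ hs => ⟨ha, hs⟩

theorem contDiffOn_comp_snd (hx : ContDiffOn ℝ ∞ x (Icc 0 1)) :
    ContDiffOn ℝ ∞ (fun p : ℝ × ℝ => x p.2) (rect T) :=
  hx.comp contDiffOn_snd fun _ hp => hp.2

/-- The functions `expFun` with boundary data depending on the second variable. -/
def expFam (x y : ℝ → ℝ) (p : ℝ × ℝ) : ℝ := expFun (x p.2) (y p.2) p.1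

/-- The derivatives of `boundaryFun` with boundary data depending on the second variable. -/
def boundaryFam (T : ℝ) (x y : ℝ → ℝ) (k : ℕ) (p : ℝ × ℝ) : ℝ :=
  boundaryDeriv k T (x p.2) (y p.2) p.1

theorem contDiffOn_expFam (hx : ContDiffOn ℝ ∞ x (Icc 0 1)) (hy : ContDiffOn ℝ ∞ y (Icc 0 1)) :
    ContDiffOn ℝ ∞ (expFam x y) (rect T) :=
  contDiffOn_expFun (contDiffOn_comp_snd hx) (contDiffOn_comp_snd hy)

theorem contDiffOn_boundaryFam (hx : ContDiffOn ℝ ∞ x (Icc 0 1))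
    (hy : ContDiffOn ℝ ∞ y (Icc 0 1)) (k : ℕ) :
    ContDiffOn ℝ ∞ (boundaryFam T x y k) (rect T) :=
  contDiffOn_boundaryDeriv k (contDiffOn_comp_snd hx) (contDiffOn_comp_snd hy)

/-- With `A + B = x` and `A - B = y`, differentiating `A e^t + B e^{-t}` exchanges `x` and `y`. -/
theorem hasDerivWithinAt_expFam (t s : ℝ) :
    HasDerivWithinAt (fun τ => expFam x y (τ, s)) (expFam y x (t, s)) (Icc 0 T) t :=
  (hasDerivAt_expFun (x s) (y s) t).hasDerivWithinAt

theorem hasDerivWithinAt_boundaryFam (k : ℕ) (t s : ℝ) :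
    HasDerivWithinAt (fun τ => boundaryFam T x y k (τ, s)) (boundaryFam T x y (k + 1) (t, s))
      (Icc 0 T) t :=
  (hasDerivAt_boundaryDeriv k T (x s) (y s) t).hasDerivWithinAt

theorem hasDerivWithinAt_Ds_of_Dt (hT : 0 < T) {f f' : ℝ × ℝ → ℝ}
    (hf : ContDiffOn ℝ ∞ f (rect T))
    (h : ∀ p ∈ rect T, HasDerivWithinAt (fun τ => f (τ, p.2)) (f' p) (Icc 0 T) p.1) {t s : ℝ}
    (ht : t ∈ Icc 0 T) (hs : s ∈ Icc (0 : ℝ) 1) :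
    HasDerivWithinAt (fun τ => Ds T f (τ, s)) (Ds T f' (t, s)) (Icc 0 T) t := by
  have hp : (t, s) ∈ rect T := ⟨ht, hs⟩
  have he : EqOn f' (Dt T f) (rect T) := fun p hp =>
    (Dt_eq_of_hasDerivWithinAt hT hf hp.1 hp.2 (h p hp)).symm
  rw [Ds_congr he hp, ← Dt_Ds_comm hT hf hp]
  exact hasDerivWithinAt_fst (contDiffOn_Ds hT hf) ht hs

theorem hasDerivWithinAt_expFam_mul_Ds (hT : 0 < T) (hx : ContDiffOn ℝ ∞ x (Icc 0 1))
    (hy : ContDiffOn ℝ ∞ y (Icc 0 1)) {t s : ℝ} (ht : t ∈ Icc 0 T) (hs : s ∈ Icc (0 : ℝ) 1) :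
    HasDerivWithinAt (fun τ => expFam y x (τ, s) * Ds T (expFam x y) (τ, s))
      (expFam x y (t, s) * Ds T (expFam x y) (t, s) +
        expFam y x (t, s) * Ds T (expFam y x) (t, s)) (Icc 0 T) t :=
  (hasDerivWithinAt_expFam t s).mul (hasDerivWithinAt_Ds_of_Dt hT (contDiffOn_expFam hx hy)
    (fun _ _ => hasDerivWithinAt_expFam _ _) ht hs)

theorem hasDerivWithinAt_boundaryFam_mul_Ds (hT : 0 < T) (hx : ContDiffOn ℝ ∞ x (Icc 0 1))
    (hy : ContDiffOn ℝ ∞ y (Icc 0 1)) (k l : ℕ) {t s : ℝ} (ht : t ∈ Icc 0 T)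
    (hs : s ∈ Icc (0 : ℝ) 1) :
    HasDerivWithinAt (fun τ => boundaryFam T x y k (τ, s) * Ds T (boundaryFam T x y l) (τ, s))
      (boundaryFam T x y (k + 1) (t, s) * Ds T (boundaryFam T x y l) (t, s) +
        boundaryFam T x y k (t, s) * Ds T (boundaryFam T x y (l + 1)) (t, s)) (Icc 0 T) t :=
  (hasDerivWithinAt_boundaryFam k t s).mul (hasDerivWithinAt_Ds_of_Dt hT
    (contDiffOn_boundaryFam hx hy l) (fun _ _ => hasDerivWithinAt_boundaryFam _ _ _) ht hs)

theorem Ds_expFam_zero (hT : 0 < T) (hx : ContDiffOn ℝ ∞ x (Icc 0 1))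
    (hy : ContDiffOn ℝ ∞ y (Icc 0 1)) {s e : ℝ} (hs : s ∈ Icc (0 : ℝ) 1)
    (h : HasDerivWithinAt x e (Icc 0 1) s) : Ds T (expFam x y) (0, s) = e := by
  refine Ds_eq_of_hasDerivWithinAt (contDiffOn_expFam hx hy) (left_mem_Icc.2 hT.le) hs ?_
  simpa only [expFam, expFun_zero] using h

theorem Ds_boundaryFam_one_zero (hT : 0 < T) (hx : ContDiffOn ℝ ∞ x (Icc 0 1))
    (hy : ContDiffOn ℝ ∞ y (Icc 0 1)) {s : ℝ} (hs : s ∈ Icc (0 : ℝ) 1) :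
    Ds T (boundaryFam T x y 1) (0, s) = 0 := by
  refine Ds_eq_of_hasDerivWithinAt (contDiffOn_boundaryFam hx hy 1) (left_mem_Icc.2 hT.le) hs ?_
  simpa only [boundaryFam, boundaryDeriv_one_zero hT] using hasDerivWithinAt_const s _ (0 : ℝ)

theorem Ds_boundaryFam_one_right (hT : 0 < T) (hx : ContDiffOn ℝ ∞ x (Icc 0 1))
    (hy : ContDiffOn ℝ ∞ y (Icc 0 1)) {s e : ℝ} (hs : s ∈ Icc (0 : ℝ) 1)
    (h : HasDerivWithinAt x e (Icc 0 1) s) : Ds T (boundaryFam T x y 1) (T, s) = e := by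
  refine Ds_eq_of_hasDerivWithinAt (contDiffOn_boundaryFam hx hy 1) (right_mem_Icc.2 hT.le) hs ?_
  simpa only [boundaryFam, boundaryDeriv_one_right hT] using h

end Families

/-! ### Families attached to a controlled variation -/

namespace DefiningTriple

variable {N M n r : ℕ} {T : ℝ} (D : DefiningTriple N M n r T)

/-- The Lagrangian `L + dC/dt`. -/
def totalLagrangian (j : Jet N n) (w : Fin M → ℝ) : ℝ := D.L j w + totalDeriv D.C j

section Variation

variable {D} {u : ℝ × ℝ → Fin M → ℝ} {F : ℝ × ℝ → Fin N → ℝ}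

namespace IsControlledVariation

theorem mapsTo_Q (h : D.IsControlledVariation u F) : MapsTo F (rect T) D.Q := fun p hp =>
  (h.2.2 p.2 hp.2).2.2.1 hp.1

theorem mapsTo_K (h : D.IsControlledVariation u F) : MapsTo u (rect T) D.K := fun p hp =>
  (D.controls _ _ (h.2.2 p.2 hp.2).1).2 hp.1

theorem jetMap_mem (h : D.IsControlledVariation u F) {p : ℝ × ℝ} (hp : p ∈ rect T) :
    jetMap n T F p ∈ jetsOver n D.Q :=
  jetMap_mem_jetsOver h.mapsTo_Q hp

theorem contDiffAt_C (h : D.IsControlledVariation u F) {p : ℝ × ℝ} (hp : p ∈ rect T) :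
    ContDiffAt ℝ ∞ D.C (jetMap n T F p) :=
  D.smooth_C.contDiffAt ((isOpen_jetsOver D.isOpen_Q).mem_nhds (h.jetMap_mem hp))

theorem contDiffAt_L (h : D.IsControlledVariation u F) {p : ℝ × ℝ} (hp : p ∈ rect T) :
    ContDiffAt ℝ ∞ (Function.uncurry D.L) (jetMap n T F p, u p) :=
  D.smooth_L _ (h.jetMap_mem hp) _ (h.mapsTo_K hp)

theorem smoothAlong_L (h : D.IsControlledVariation u F) : SmoothAlong T D.L u F :=
  ⟨h.1, h.2.1, fun _ hp => h.contDiffAt_L hp⟩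

theorem smoothAlong_C (h : D.IsControlledVariation u F) :
    SmoothAlong T (fun (j : Jet N n) (_ : Fin M → ℝ) => D.C j) u F :=
  ⟨h.1, h.2.1, fun _ hp => ContDiffAt.comp (g := D.C) (f := Prod.fst) _ (h.contDiffAt_C hp)
    contDiffAt_fst⟩

theorem smoothAlong_totalLagrangian (h : D.IsControlledVariation u F) :
    SmoothAlong T D.totalLagrangian u F :=
  ⟨h.1, h.2.1, fun _ hp => (h.contDiffAt_L hp).add
    (ContDiffAt.comp (g := totalDeriv D.C) (f := Prod.fst) _
      (contDiffAt_totalDeriv (h.contDiffAt_C hp)) contDiffAt_fst)⟩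

theorem pderivAlong_L_eq_zero (h : D.IsControlledVariation u F) {p : ℝ × ℝ} (hp : p ∈ rect T)
    (i : Fin N) {δ : ℕ} (hδ : r < δ) : pderivAlong T D.L u F i δ p = 0 := by
  by_cases hn : δ < n + 1
  · rw [pderivAlong_of_lt hn]
    refine (D.order_L _ (h.mapsTo_K hp)).pderivQ_eq_zero (h.jetMap_mem hp) ?_ hδ i
    exact ((h.smoothAlong_L.differentiableAt hp).hasFDerivAt.comp (f := fun j => (j, u p)) _
      (hasFDerivAt_prodMk_left _ _)).differentiableAt
  · exact dif_neg hn

theorem pderivAlong_C_eq_zero (h : D.IsControlledVariation u F) {p : ℝ × ℝ} (hp : p ∈ rect T)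
    (i : Fin N) {δ : ℕ} (hδ : r - 1 < δ) :
    pderivAlong T (fun (j : Jet N n) (_ : Fin M → ℝ) => D.C j) u F i δ p = 0 := by
  by_cases hn : δ < n + 1
  · rw [pderivAlong_of_lt hn]
    exact D.order_C.pderivQ_eq_zero (h.jetMap_mem hp)
      ((h.contDiffAt_C hp).differentiableAt (by simp)) hδ i
  · exact dif_neg hn

/-- The commutation of `∂/∂q_(δ+1)` with `d/dt`, applied to `C`, whose actual order `r - 1` is below
`n`. It is the input of `ostrogradsky_eq_add`. -/
theorem pderivAlong_totalLagrangian (h : D.IsControlledVariation u F) {p : ℝ × ℝ}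
    (hp : p ∈ rect T) (i : Fin N) {δ : ℕ} (hδ : δ < r) :
    pderivAlong T D.totalLagrangian u F i (δ + 1) p =
      pderivAlong T D.L u F i (δ + 1) p +
        Dt T (pderivAlong T (fun (j : Jet N n) (_ : Fin M → ℝ) => D.C j) u F i (δ + 1)) p +
        pderivAlong T (fun (j : Jet N n) (_ : Fin M → ℝ) => D.C j) u F i δ p := by
  have hrn : δ < n := by have := D.order_le; omega
  have hrn' : r - 1 < n := by have := D.order_le; omega
  have hC := Dt_pderivQ_jetMap D.T_pos D.isOpen_Q h.2.1 h.mapsTo_Q D.smooth_C hrn' D.order_C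
    ⟨δ, hrn⟩ i hp
  have hL : DifferentiableAt ℝ (fun j => D.L j (u p)) (jetMap n T F p) :=
    ((h.smoothAlong_L.differentiableAt hp).hasFDerivAt.comp (f := fun j => (j, u p)) _
      (hasFDerivAt_prodMk_left _ _)).differentiableAt
  have hdC : DifferentiableAt ℝ (totalDeriv D.C) (jetMap n T F p) :=
    (contDiffAt_totalDeriv (h.contDiffAt_C hp)).differentiableAt (by simp)
  have hfun : pderivAlong T (fun (j : Jet N n) (_ : Fin M → ℝ) => D.C j) u F i (δ + 1) =
      fun q => pderivQ D.C (Fin.succ ⟨δ, hrn⟩) i (jetMap n T F q) :=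
    funext fun q => pderivAlong_of_lt (by omega) q
  rw [hfun, add_assoc, pderivAlong_of_lt (show δ < n + 1 by omega) p]
  refine Eq.trans ?_ (congrArg _ hC)
  rw [pderivAlong_of_lt (show δ + 1 < n + 1 by omega), pderivAlong_of_lt (show δ + 1 < n + 1 by omega)]
  simp only [totalLagrangian, pderivQ]
  rw [fderiv_fun_add hL hdC]
  rfl

end IsControlledVariation

end Variation

/-- The momenta `p^L_β` along a homotopy. -/
def momentumFam (u : ℝ × ℝ → Fin M → ℝ) (F : ℝ × ℝ → Fin N → ℝ) (β : ℕ) (i : Fin N) :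
    ℝ × ℝ → ℝ :=
  ostrogradsky r T (pderivAlong T D.L u F i) β

/-- The momenta `p^{L + dC/dt}_β` along a homotopy. -/
def totalMomentumFam (u : ℝ × ℝ → Fin M → ℝ) (F : ℝ × ℝ → Fin N → ℝ) (β : ℕ) (i : Fin N) :
    ℝ × ℝ → ℝ :=
  ostrogradsky r T (pderivAlong T D.totalLagrangian u F i) β

/-- The functions `h` along a homotopy. -/
def zeroFam (u : ℝ × ℝ → Fin M → ℝ) (F : ℝ × ℝ → Fin N → ℝ) (β : ℕ) (i : Fin N) :
    ℝ × ℝ → ℝ :=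
  expFam (fun s => ((Dt T)^[β] F) (0, s) i) (fun s => -D.momentumFam u F β i (0, s))

/-- The first derivatives of the functions `h` along a homotopy. -/
def zeroDerivFam (u : ℝ × ℝ → Fin M → ℝ) (F : ℝ × ℝ → Fin N → ℝ) (β : ℕ) (i : Fin N) :
    ℝ × ℝ → ℝ :=
  expFam (fun s => -D.momentumFam u F β i (0, s)) (fun s => ((Dt T)^[β] F) (0, s) i)

/-- The derivatives of the functions `h'` along a homotopy. -/
def primeFam (u : ℝ × ℝ → Fin M → ℝ) (F : ℝ × ℝ → Fin N → ℝ) (β : ℕ) (i : Fin N) :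
    ℕ → ℝ × ℝ → ℝ :=
  boundaryFam T (fun s => ((Dt T)^[β] F) (T, s) i) (fun s => D.totalMomentumFam u F β i (T, s))

/-- The derivatives of the functions `h''` along a homotopy. -/
def secondFam (u : ℝ × ℝ → Fin M → ℝ) (F : ℝ × ℝ → Fin N → ℝ) (β : ℕ) (i : Fin N) :
    ℕ → ℝ × ℝ → ℝ :=
  boundaryFam T (fun s => D.zeroFam u F β i (T, s)) (fun s => D.zeroDerivFam u F β i (T, s))

/-- The integrand of `μ` along a homotopy. -/
def muIntegrand (u : ℝ × ℝ → Fin M → ℝ) (F : ℝ × ℝ → Fin N → ℝ) (p : ℝ × ℝ) : ℝ :=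
  D.L (jetMap n T F p) (u p) +
    1 / 2 * ∑ β ∈ Finset.range r, ∑ i : Fin N,
      (D.zeroDerivFam u F β i p ^ 2 - D.primeFam u F β i 2 p ^ 2 - D.secondFam u F β i 2 p ^ 2) +
    ∑ β ∈ Finset.range r, ∑ i : Fin N,
      (1 / 2 * D.zeroFam u F β i p ^ 2 +
        Real.pi ^ 4 / (32 * T ^ 4) * D.primeFam u F β i 0 p ^ 2 +
        Real.pi ^ 4 / (32 * T ^ 4) * D.secondFam u F β i 0 p ^ 2)

/-- The function whose time derivative is the integrand of the labour. -/
def labourPotential (u : ℝ × ℝ → Fin M → ℝ) (F : ℝ × ℝ → Fin N → ℝ) (p : ℝ × ℝ) : ℝ :=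
  ∑ β ∈ Finset.range r, ∑ i : Fin N,
    (D.momentumFam u F β i p * Ds T ((Dt T)^[β] F) p i +
      D.zeroDerivFam u F β i p * Ds T (D.zeroFam u F β i) p -
      D.primeFam u F β i 2 p * Ds T (D.primeFam u F β i 1) p -
      D.secondFam u F β i 2 p * Ds T (D.secondFam u F β i 1) p)

/-! ### Regularity and boundary values of the labour potential -/

namespace IsControlledVariation

variable {D} {u : ℝ × ℝ → Fin M → ℝ} {F : ℝ × ℝ → Fin N → ℝ}

/-- The induction can start at `β = r` because `C` does not depend on `q_(r)`. -/
theorem totalMomentumFam_eq (h : D.IsControlledVariation u F) {β : ℕ} (hβ : β ≤ r) (i : Fin N)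
    {p : ℝ × ℝ} (hp : p ∈ rect T) :
    D.totalMomentumFam u F β i p = D.momentumFam u F β i p +
      pderivAlong T (fun (j : Jet N n) (_ : Fin M → ℝ) => D.C j) u F i β p :=
  ostrogradsky_eq_add D.T_pos (h.smoothAlong_L.contDiffOn_pderivAlong D.T_pos i)
    (h.smoothAlong_totalLagrangian.contDiffOn_pderivAlong D.T_pos i)
    (h.smoothAlong_C.contDiffOn_pderivAlong D.T_pos i)
    (fun _ hq => h.pderivAlong_C_eq_zero hq i (by have := D.one_le_r; omega))
    (fun _ hδ _ hq => h.pderivAlong_totalLagrangian hq i hδ) hβ p hp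

theorem contDiffOn_momentumFam (h : D.IsControlledVariation u F) (β : ℕ) (i : Fin N) :
    ContDiffOn ℝ ∞ (D.momentumFam u F β i) (rect T) :=
  contDiffOn_ostrogradsky D.T_pos (h.smoothAlong_L.contDiffOn_pderivAlong D.T_pos i) β

theorem contDiffOn_totalMomentumFam (h : D.IsControlledVariation u F) (β : ℕ) (i : Fin N) :
    ContDiffOn ℝ ∞ (D.totalMomentumFam u F β i) (rect T) :=
  contDiffOn_ostrogradsky D.T_pos
    (h.smoothAlong_totalLagrangian.contDiffOn_pderivAlong D.T_pos i) β

theorem contDiffOn_coord (h : D.IsControlledVariation u F) (β : ℕ) (i : Fin N) {a : ℝ}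
    (ha : a ∈ Icc 0 T) : ContDiffOn ℝ ∞ (fun s => ((Dt T)^[β] F) (a, s) i) (Icc 0 1) :=
  contDiffOn_pi.1 (contDiffOn_slice (contDiffOn_iterate_Dt D.T_pos h.2.1 β) ha) i

theorem hasDerivWithinAt_coord (h : D.IsControlledVariation u F) (β : ℕ) (i : Fin N) {a s : ℝ}
    (ha : a ∈ Icc 0 T) (hs : s ∈ Icc (0 : ℝ) 1) :
    HasDerivWithinAt (fun s => ((Dt T)^[β] F) (a, s) i) (Ds T ((Dt T)^[β] F) (a, s) i)
      (Icc 0 1) s :=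
  hasDerivWithinAt_pi.1
    (hasDerivWithinAt_snd (contDiffOn_iterate_Dt D.T_pos h.2.1 β) ha hs) i

theorem zero_mem (D : DefiningTriple N M n r T) : (0 : ℝ) ∈ Icc 0 T := left_mem_Icc.2 D.T_pos.le

theorem right_mem (D : DefiningTriple N M n r T) : T ∈ Icc 0 T := right_mem_Icc.2 D.T_pos.le

theorem contDiffOn_initialMomentum (h : D.IsControlledVariation u F) (β : ℕ) (i : Fin N) :
    ContDiffOn ℝ ∞ (fun s => -D.momentumFam u F β i (0, s)) (Icc 0 1) :=
  (contDiffOn_slice (h.contDiffOn_momentumFam β i) (zero_mem D)).neg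

theorem contDiffOn_terminalMomentum (h : D.IsControlledVariation u F) (β : ℕ) (i : Fin N) :
    ContDiffOn ℝ ∞ (fun s => D.totalMomentumFam u F β i (T, s)) (Icc 0 1) :=
  contDiffOn_slice (h.contDiffOn_totalMomentumFam β i) (right_mem D)

theorem contDiffOn_zeroFam (h : D.IsControlledVariation u F) (β : ℕ) (i : Fin N) :
    ContDiffOn ℝ ∞ (D.zeroFam u F β i) (rect T) :=
  contDiffOn_expFam (h.contDiffOn_coord β i (zero_mem D)) (h.contDiffOn_initialMomentum β i)

theorem contDiffOn_zeroDerivFam (h : D.IsControlledVariation u F) (β : ℕ) (i : Fin N) :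
    ContDiffOn ℝ ∞ (D.zeroDerivFam u F β i) (rect T) :=
  contDiffOn_expFam (h.contDiffOn_initialMomentum β i) (h.contDiffOn_coord β i (zero_mem D))

theorem contDiffOn_primeFam (h : D.IsControlledVariation u F) (β : ℕ) (i : Fin N) (k : ℕ) :
    ContDiffOn ℝ ∞ (D.primeFam u F β i k) (rect T) :=
  contDiffOn_boundaryFam (h.contDiffOn_coord β i (right_mem D))
    (h.contDiffOn_terminalMomentum β i) k

theorem contDiffOn_secondFam (h : D.IsControlledVariation u F) (β : ℕ) (i : Fin N) (k : ℕ) :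
    ContDiffOn ℝ ∞ (D.secondFam u F β i k) (rect T) :=
  contDiffOn_boundaryFam (contDiffOn_slice (h.contDiffOn_zeroFam β i) (right_mem D))
    (contDiffOn_slice (h.contDiffOn_zeroDerivFam β i) (right_mem D)) k

theorem contDiffOn_muIntegrand (h : D.IsControlledVariation u F) :
    ContDiffOn ℝ ∞ (D.muIntegrand u F) (rect T) := by
  refine ((h.smoothAlong_L.contDiffOn_comp D.T_pos).add (contDiffOn_const.mul
    (ContDiffOn.sum fun β _ => ContDiffOn.sum fun i _ => ?_))).add
    (ContDiffOn.sum fun β _ => ContDiffOn.sum fun i _ => ?_)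
  · exact (((h.contDiffOn_zeroDerivFam β i).pow 2).sub ((h.contDiffOn_primeFam β i 2).pow 2)).sub
      ((h.contDiffOn_secondFam β i 2).pow 2)
  · exact ((contDiffOn_const.mul ((h.contDiffOn_zeroFam β i).pow 2)).add
      (contDiffOn_const.mul ((h.contDiffOn_primeFam β i 0).pow 2))).add
      (contDiffOn_const.mul ((h.contDiffOn_secondFam β i 0).pow 2))

theorem contDiffOn_labourPotential (h : D.IsControlledVariation u F) :
    ContDiffOn ℝ ∞ (D.labourPotential u F) (rect T) := by
  refine ContDiffOn.sum fun β _ => ContDiffOn.sum fun i _ => ?_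
  have hT := D.T_pos
  exact ((((h.contDiffOn_momentumFam β i).mul
    (contDiffOn_pi.1 (contDiffOn_Ds hT (contDiffOn_iterate_Dt hT h.2.1 β)) i)).add
    ((h.contDiffOn_zeroDerivFam β i).mul (contDiffOn_Ds hT (h.contDiffOn_zeroFam β i)))).sub
    ((h.contDiffOn_primeFam β i 2).mul (contDiffOn_Ds hT (h.contDiffOn_primeFam β i 1)))).sub
    ((h.contDiffOn_secondFam β i 2).mul (contDiffOn_Ds hT (h.contDiffOn_secondFam β i 1)))

/-- The total variation of the terminal cost. -/
theorem Ds_cost (h : D.IsControlledVariation u F) {p : ℝ × ℝ} (hp : p ∈ rect T) :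
    Ds T (fun q => D.C (jetMap n T F q)) p =
      ∑ β ∈ Finset.range r, ∑ i,
        pderivAlong T (fun (j : Jet N n) (_ : Fin M → ℝ) => D.C j) u F i β p *
          Ds T ((Dt T)^[β] F) p i := by
  have hr := D.one_le_r
  have := h.smoothAlong_C.Ds_comp_eq D.T_pos (k := r - 1) (by have := D.order_le; omega) hp
    (fun i δ hδ => h.pderivAlong_C_eq_zero hp i hδ)
  rw [this, Finset.sum_comm, Nat.sub_add_cancel hr]
  simp

/-- The data of `h` at `t = 0` make `h_(1) ∂_s h` cancel `p_β ∂_s q_(β)`. The slopes of `h'` and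
`h''` vanish there for every `s`, hence so do their `s`-derivatives. -/
theorem labourPotential_zero (h : D.IsControlledVariation u F) {s : ℝ}
    (hs : s ∈ Icc (0 : ℝ) 1) : D.labourPotential u F (0, s) = 0 := by
  refine Finset.sum_eq_zero fun β _ => Finset.sum_eq_zero fun i _ => ?_
  have hT := D.T_pos
  have e1 : Ds T (D.zeroFam u F β i) (0, s) = Ds T ((Dt T)^[β] F) (0, s) i :=
    Ds_expFam_zero hT (h.contDiffOn_coord β i (zero_mem D)) (h.contDiffOn_initialMomentum β i) hs
      (h.hasDerivWithinAt_coord β i (zero_mem D) hs)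
  have e2 : D.zeroDerivFam u F β i (0, s) = -D.momentumFam u F β i (0, s) := expFun_zero _ _
  have e3 : Ds T (D.primeFam u F β i 1) (0, s) = 0 :=
    Ds_boundaryFam_one_zero hT (h.contDiffOn_coord β i (right_mem D))
      (h.contDiffOn_terminalMomentum β i) hs
  have e4 : Ds T (D.secondFam u F β i 1) (0, s) = 0 :=
    Ds_boundaryFam_one_zero hT (contDiffOn_slice (h.contDiffOn_zeroFam β i) (right_mem D))
      (contDiffOn_slice (h.contDiffOn_zeroDerivFam β i) (right_mem D)) hs
  rw [e1, e2, e3, e4]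
  ring

/-- The data of `h''` at `T` are those of `h`, so these two products cancel. Those of `h'` leave the
difference of the momenta of `L` and `L + dC/dt`, that is `-∂C/∂q_(β)`, paired with `∂_s q_(β)`. -/
theorem labourPotential_right (h : D.IsControlledVariation u F) {s : ℝ}
    (hs : s ∈ Icc (0 : ℝ) 1) :
    D.labourPotential u F (T, s) = -Ds T (fun q => D.C (jetMap n T F q)) (T, s) := by
  have hT := D.T_pos
  have hp : (T, s) ∈ rect T := ⟨right_mem D, hs⟩
  rw [h.Ds_cost hp, ← Finset.sum_neg_distrib]
  refine Finset.sum_congr rfl fun β hβ => ?_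
  rw [← Finset.sum_neg_distrib]
  refine Finset.sum_congr rfl fun i _ => ?_
  have e1 : Ds T (D.primeFam u F β i 1) (T, s) = Ds T ((Dt T)^[β] F) (T, s) i :=
    Ds_boundaryFam_one_right hT (h.contDiffOn_coord β i (right_mem D))
      (h.contDiffOn_terminalMomentum β i) hs (h.hasDerivWithinAt_coord β i (right_mem D) hs)
  have e2 : D.primeFam u F β i 2 (T, s) = D.totalMomentumFam u F β i (T, s) :=
    boundaryDeriv_two_right hT _ _
  have e3 : Ds T (D.secondFam u F β i 1) (T, s) = Ds T (D.zeroFam u F β i) (T, s) :=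
    Ds_boundaryFam_one_right hT (contDiffOn_slice (h.contDiffOn_zeroFam β i) (right_mem D))
      (contDiffOn_slice (h.contDiffOn_zeroDerivFam β i) (right_mem D)) hs
      (hasDerivWithinAt_snd (h.contDiffOn_zeroFam β i) (right_mem D) hs)
  have e4 : D.secondFam u F β i 2 (T, s) = D.zeroDerivFam u F β i (T, s) :=
    boundaryDeriv_two_right hT _ _
  rw [e1, e2, e3, e4, h.totalMomentumFam_eq (Finset.mem_range.1 hβ).le i hp]
  ring

theorem Ds_muIntegrand (h : D.IsControlledVariation u F) {t s : ℝ} (ht : t ∈ Icc 0 T)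
    (hs : s ∈ Icc (0 : ℝ) 1) :
    Ds T (D.muIntegrand u F) (t, s) =
      Ds T (fun q => D.L (jetMap n T F q) (u q)) (t, s) +
      ∑ β ∈ Finset.range r, ∑ i : Fin N,
        (D.zeroDerivFam u F β i (t, s) * Ds T (D.zeroDerivFam u F β i) (t, s) +
          D.zeroFam u F β i (t, s) * Ds T (D.zeroFam u F β i) (t, s) -
          D.primeFam u F β i 2 (t, s) * Ds T (D.primeFam u F β i 2) (t, s) -
          D.secondFam u F β i 2 (t, s) * Ds T (D.secondFam u F β i 2) (t, s) +
          freq T ^ 4 * (D.primeFam u F β i 0 (t, s) * Ds T (D.primeFam u F β i 0) (t, s) +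
            D.secondFam u F β i 0 (t, s) * Ds T (D.secondFam u F β i 0) (t, s))) := by
  refine Ds_eq_of_hasDerivWithinAt h.contDiffOn_muIntegrand ht hs ?_
  have hd : ∀ {f : ℝ × ℝ → ℝ}, ContDiffOn ℝ ∞ f (rect T) →
      HasDerivWithinAt (fun v => f (t, v)) (Ds T f (t, s)) (Icc 0 1) s := fun hf =>
    hasDerivWithinAt_snd hf ht hs
  have H := ((hd (h.smoothAlong_L.contDiffOn_comp D.T_pos)).add (HasDerivWithinAt.const_mul
      (1 / 2 : ℝ) (HasDerivWithinAt.fun_sum (u := Finset.range r) fun β _ =>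
        HasDerivWithinAt.fun_sum (u := (Finset.univ : Finset (Fin N))) fun i _ =>
        (((hd (h.contDiffOn_zeroDerivFam β i)).pow 2).sub
          ((hd (h.contDiffOn_primeFam β i 2)).pow 2)).sub
          ((hd (h.contDiffOn_secondFam β i 2)).pow 2)))).add
      (HasDerivWithinAt.fun_sum (u := Finset.range r) fun β _ =>
        HasDerivWithinAt.fun_sum (u := (Finset.univ : Finset (Fin N))) fun i _ =>
        ((((hd (h.contDiffOn_zeroFam β i)).pow 2).const_mul (1 / 2 : ℝ)).add
          (((hd (h.contDiffOn_primeFam β i 0)).pow 2).const_mul (Real.pi ^ 4 / (32 * T ^ 4)))).add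
          (((hd (h.contDiffOn_secondFam β i 0)).pow 2).const_mul (Real.pi ^ 4 / (32 * T ^ 4))))
  refine H.congr_deriv ?_
  rw [add_assoc, Finset.mul_sum, ← Finset.sum_add_distrib]
  congr 1
  refine Finset.sum_congr rfl fun β _ => ?_
  rw [Finset.mul_sum, ← Finset.sum_add_distrib]
  refine Finset.sum_congr rfl fun i _ => ?_
  -- `ω⁴ = π⁴/(16T⁴)` is twice the coefficient in `μ`; the factor two comes from differentiating a
  -- square.
  have hfreq : freq T ^ 4 = 2 * (Real.pi ^ 4 / (32 * T ^ 4)) := by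
    have := D.T_pos.ne'
    simp only [freq]; field_simp; norm_num
  rw [hfreq]
  simp
  ring

end IsControlledVariation

end DefiningTriple

namespace DefiningTriple

variable {N M n r : ℕ} {T : ℝ}

/-! ### The labour of a variation is the decrease of the cost -/

namespace IsControlledVariation

variable {D : DefiningTriple N M n r T} {u : ℝ × ℝ → Fin M → ℝ} {F : ℝ × ℝ → Fin N → ℝ}

theorem hZero_eq (h : D.IsControlledVariation u F) (β : ℕ) (i : Fin N) {s : ℝ}
    (hs : s ∈ Icc (0 : ℝ) 1) :
    D.hZero (fun τ => u (τ, s)) (fun τ => F (τ, s)) β i = fun t => D.zeroFam u F β i (t, s) := by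
  have hr : r ≤ n := by have := D.order_le; omega
  funext t
  rw [hZero, iteratedDerivWithin_fst D.T_pos h.2.1 β (zero_mem D) hs,
    h.smoothAlong_L.momentum_eq D.T_pos hr β i (zero_mem D) hs]
  rfl

theorem deriv_hZero_eq (h : D.IsControlledVariation u F) (β : ℕ) (i : Fin N) {s : ℝ}
    (hs : s ∈ Icc (0 : ℝ) 1) (t : ℝ) :
    deriv (D.hZero (fun τ => u (τ, s)) (fun τ => F (τ, s)) β i) t =
      D.zeroDerivFam u F β i (t, s) := by
  rw [h.hZero_eq β i hs]
  exact (hasDerivAt_expFun (((Dt T)^[β] F) (0, s) i) (-D.momentumFam u F β i (0, s)) t).deriv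

theorem iteratedDeriv_hPrime_eq (h : D.IsControlledVariation u F) (β : ℕ) (i : Fin N) (k : ℕ)
    {s : ℝ} (hs : s ∈ Icc (0 : ℝ) 1) (t : ℝ) :
    iteratedDeriv k (D.hPrime (fun τ => u (τ, s)) (fun τ => F (τ, s)) β i) t =
      D.primeFam u F β i k (t, s) := by
  have hr : r ≤ n := by have := D.order_le; omega
  have hm := h.smoothAlong_totalLagrangian.momentum_eq D.T_pos hr β i (right_mem D) hs
  have hfun : D.hPrime (fun τ => u (τ, s)) (fun τ => F (τ, s)) β i =
      boundaryFun T (((Dt T)^[β] F) (T, s) i) (D.totalMomentumFam u F β i (T, s)) := by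
    funext t
    rw [hPrime, iteratedDerivWithin_fst D.T_pos h.2.1 β (right_mem D) hs]
    exact congrArg (fun y => boundaryFun T (((Dt T)^[β] F) (T, s) i) y t) hm
  rw [hfun, iteratedDeriv_boundaryFun]
  rfl

theorem iteratedDeriv_hSecond_eq (h : D.IsControlledVariation u F) (β : ℕ) (i : Fin N) (k : ℕ)
    {s : ℝ} (hs : s ∈ Icc (0 : ℝ) 1) (t : ℝ) :
    iteratedDeriv k (D.hSecond (fun τ => u (τ, s)) (fun τ => F (τ, s)) β i) t =
      D.secondFam u F β i k (t, s) := by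
  have hfun : D.hSecond (fun τ => u (τ, s)) (fun τ => F (τ, s)) β i =
      boundaryFun T (D.zeroFam u F β i (T, s)) (D.zeroDerivFam u F β i (T, s)) := by
    funext t
    rw [hSecond, h.deriv_hZero_eq β i hs, h.hZero_eq β i hs]
  rw [hfun, iteratedDeriv_boundaryFun]
  rfl

theorem hPrime_eq (h : D.IsControlledVariation u F) (β : ℕ) (i : Fin N) {s : ℝ}
    (hs : s ∈ Icc (0 : ℝ) 1) (t : ℝ) :
    D.hPrime (fun τ => u (τ, s)) (fun τ => F (τ, s)) β i t = D.primeFam u F β i 0 (t, s) := by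
  rw [← h.iteratedDeriv_hPrime_eq β i 0 hs, iteratedDeriv_zero]

theorem hSecond_eq (h : D.IsControlledVariation u F) (β : ℕ) (i : Fin N) {s : ℝ}
    (hs : s ∈ Icc (0 : ℝ) 1) (t : ℝ) :
    D.hSecond (fun τ => u (τ, s)) (fun τ => F (τ, s)) β i t = D.secondFam u F β i 0 (t, s) := by
  rw [← h.iteratedDeriv_hSecond_eq β i 0 hs, iteratedDeriv_zero]

theorem mu_eq (h : D.IsControlledVariation u F) (t : ℝ) {s : ℝ} (hs : s ∈ Icc (0 : ℝ) 1) :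
    D.mu u F t s = -∫ τ in (0 : ℝ)..t, D.muIntegrand u F (τ, s) := by
  simp only [mu, h.deriv_hZero_eq _ _ hs, h.iteratedDeriv_hPrime_eq _ _ _ hs,
    h.iteratedDeriv_hSecond_eq _ _ _ hs, h.hPrime_eq _ _ hs, h.hSecond_eq _ _ hs]
  simp only [h.hZero_eq _ _ hs]
  rfl

theorem derivWithin_hPrime (h : D.IsControlledVariation u F) (β : ℕ) (i : Fin N) {t s : ℝ}
    (ht : t ∈ Icc 0 T) (hs : s ∈ Icc (0 : ℝ) 1) :
    derivWithin (fun s' => D.hPrime (fun τ => u (τ, s')) (fun τ => F (τ, s')) β i t) (Icc 0 1) s =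
      Ds T (D.primeFam u F β i 0) (t, s) := by
  rw [derivWithin_congr (fun v hv => h.hPrime_eq β i hv t) (h.hPrime_eq β i hs t)]
  exact (hasDerivWithinAt_snd (h.contDiffOn_primeFam β i 0) ht hs).derivWithin
    (uniqueDiffOn_Icc one_pos s hs)

theorem derivWithin_hSecond (h : D.IsControlledVariation u F) (β : ℕ) (i : Fin N) {t s : ℝ}
    (ht : t ∈ Icc 0 T) (hs : s ∈ Icc (0 : ℝ) 1) :
    derivWithin (fun s' => D.hSecond (fun τ => u (τ, s')) (fun τ => F (τ, s')) β i t) (Icc 0 1) s =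
      Ds T (D.secondFam u F β i 0) (t, s) := by
  rw [derivWithin_congr (fun v hv => h.hSecond_eq β i hv t) (h.hSecond_eq β i hs t)]
  exact (hasDerivWithinAt_snd (h.contDiffOn_secondFam β i 0) ht hs).derivWithin
    (uniqueDiffOn_Icc one_pos s hs)

theorem muPrime_eq (h : D.IsControlledVariation u F) {t s : ℝ} (ht : t ∈ Icc 0 T)
    (hs : s ∈ Icc (0 : ℝ) 1) :
    D.muPrime u F t s = -(∫ τ in (0 : ℝ)..t, D.muIntegrand u F (τ, s)) +
      ∑ β ∈ Finset.range r, ∑ i : Fin N, ∫ v in (0 : ℝ)..s,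
        (D.primeFam u F β i 3 (t, v) * Ds T (D.primeFam u F β i 0) (t, v) +
          D.secondFam u F β i 3 (t, v) * Ds T (D.secondFam u F β i 0) (t, v)) := by
  rw [muPrime, h.mu_eq t hs]
  congr 1
  refine Finset.sum_congr rfl fun β _ => Finset.sum_congr rfl fun i _ => ?_
  refine intervalIntegral.integral_congr fun v hv => ?_
  rw [uIcc_of_le hs.1] at hv
  have hv' : v ∈ Icc (0 : ℝ) 1 := ⟨hv.1, hv.2.trans hs.2⟩
  simp only [h.iteratedDeriv_hPrime_eq _ _ _ hv', h.iteratedDeriv_hSecond_eq _ _ _ hv',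
    h.derivWithin_hPrime _ _ ht hv', h.derivWithin_hSecond _ _ ht hv']

/-- The `s`-derivative undoes the integration over `v` in the correction and passes under the
integral in `μ`. -/
theorem derivWithin_muPrime (h : D.IsControlledVariation u F) {t s : ℝ} (ht : t ∈ Icc 0 T)
    (hs : s ∈ Icc (0 : ℝ) 1) :
    derivWithin (fun s' => D.muPrime u F t s') (Icc 0 1) s =
      -(∫ τ in (0 : ℝ)..t, Ds T (D.muIntegrand u F) (τ, s)) +
      ∑ β ∈ Finset.range r, ∑ i : Fin N,
        (D.primeFam u F β i 3 (t, s) * Ds T (D.primeFam u F β i 0) (t, s) +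
          D.secondFam u F β i 3 (t, s) * Ds T (D.secondFam u F β i 0) (t, s)) := by
  have hT := D.T_pos
  rw [derivWithin_congr (fun v hv => h.muPrime_eq ht hv) (h.muPrime_eq ht hs)]
  refine HasDerivWithinAt.derivWithin ?_ (uniqueDiffOn_Icc one_pos s hs)
  refine (hasDerivWithinAt_parametric_integral hT h.contDiffOn_muIntegrand ht hs).neg.add
    (HasDerivWithinAt.fun_sum fun β _ => HasDerivWithinAt.fun_sum fun i _ =>
      hasDerivWithinAt_primitive one_pos ?_ hs)
  have hc : ∀ {f : ℝ × ℝ → ℝ}, ContDiffOn ℝ ∞ f (rect T) →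
      ContinuousOn (fun v => f (t, v)) (Icc 0 1) := fun hf => (contDiffOn_slice hf ht).continuousOn
  exact ((hc (h.contDiffOn_primeFam β i 3)).mul
    (hc (contDiffOn_Ds hT (h.contDiffOn_primeFam β i 0)))).add
    ((hc (h.contDiffOn_secondFam β i 3)).mul
      (hc (contDiffOn_Ds hT (h.contDiffOn_secondFam β i 0))))

/-- The product rule on `h'_(3) ∂_s h'` produces `h'_(4) = ω⁴ h'`, and likewise for `h''`. -/
theorem derivWithin_derivWithin_muPrime (h : D.IsControlledVariation u F) {t s : ℝ}
    (ht : t ∈ Icc 0 T) (hs : s ∈ Icc (0 : ℝ) 1) :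
    derivWithin (fun t' => derivWithin (fun s' => D.muPrime u F t' s') (Icc 0 1) s) (Icc 0 T) t =
      -Ds T (D.muIntegrand u F) (t, s) +
      ∑ β ∈ Finset.range r, ∑ i : Fin N,
        ((freq T ^ 4 * D.primeFam u F β i 0 (t, s) * Ds T (D.primeFam u F β i 0) (t, s) +
            D.primeFam u F β i 3 (t, s) * Ds T (D.primeFam u F β i 1) (t, s)) +
          (freq T ^ 4 * D.secondFam u F β i 0 (t, s) * Ds T (D.secondFam u F β i 0) (t, s) +
            D.secondFam u F β i 3 (t, s) * Ds T (D.secondFam u F β i 1) (t, s))) := by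
  have hT := D.T_pos
  rw [derivWithin_congr (fun v hv => h.derivWithin_muPrime hv hs) (h.derivWithin_muPrime ht hs)]
  refine HasDerivWithinAt.derivWithin ?_ (uniqueDiffOn_Icc hT t ht)
  have hcont : ContinuousOn (fun τ => Ds T (D.muIntegrand u F) (τ, s)) (Icc 0 T) := fun τ hτ =>
    (hasDerivWithinAt_fst (contDiffOn_Ds hT h.contDiffOn_muIntegrand) hτ hs).continuousWithinAt
  refine (hasDerivWithinAt_primitive hT hcont ht).neg.add
    (HasDerivWithinAt.fun_sum fun β _ => HasDerivWithinAt.fun_sum fun i _ => ?_)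
  have e1 : freq T ^ 4 * D.primeFam u F β i 0 (t, s) = D.primeFam u F β i 4 (t, s) :=
    (boundaryDeriv_four _ _ _ _).symm
  have e2 : freq T ^ 4 * D.secondFam u F β i 0 (t, s) = D.secondFam u F β i 4 (t, s) :=
    (boundaryDeriv_four _ _ _ _).symm
  rw [e1, e2]
  exact (hasDerivWithinAt_boundaryFam_mul_Ds hT (h.contDiffOn_coord β i (right_mem D))
      (h.contDiffOn_terminalMomentum β i) 3 0 ht hs).add
    (hasDerivWithinAt_boundaryFam_mul_Ds hT
      (contDiffOn_slice (h.contDiffOn_zeroFam β i) (right_mem D))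
      (contDiffOn_slice (h.contDiffOn_zeroDerivFam β i) (right_mem D)) 3 0 ht hs)

/-- The momentum part uses the Euler-Lagrange equations satisfied by each `F(·, s)`; the remaining
products need only the product rule and `h_(2) = h`. -/
theorem Dt_labourPotential (h : D.IsControlledVariation u F) {t s : ℝ} (ht : t ∈ Icc 0 T)
    (hs : s ∈ Icc (0 : ℝ) 1) :
    Dt T (D.labourPotential u F) (t, s) =
      ∑ i : Fin N, ∑ β ∈ Finset.range (r + 1),
        pderivAlong T D.L u F i β (t, s) * Ds T ((Dt T)^[β] F) (t, s) i +
      ∑ β ∈ Finset.range r, ∑ i : Fin N,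
        (D.zeroFam u F β i (t, s) * Ds T (D.zeroFam u F β i) (t, s) +
          D.zeroDerivFam u F β i (t, s) * Ds T (D.zeroDerivFam u F β i) (t, s) -
          (D.primeFam u F β i 3 (t, s) * Ds T (D.primeFam u F β i 1) (t, s) +
            D.primeFam u F β i 2 (t, s) * Ds T (D.primeFam u F β i 2) (t, s)) -
          (D.secondFam u F β i 3 (t, s) * Ds T (D.secondFam u F β i 1) (t, s) +
            D.secondFam u F β i 2 (t, s) * Ds T (D.secondFam u F β i 2) (t, s))) := by
  have hT := D.T_pos
  have hr : r ≤ n := by have := D.order_le; omega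
  refine Dt_eq_of_hasDerivWithinAt hT h.contDiffOn_labourPotential ht hs ?_
  have h1 := HasDerivWithinAt.fun_sum (u := (Finset.univ : Finset (Fin N))) fun i _ =>
    h.smoothAlong_L.hasDerivWithinAt_sum_momentum hT hr i ht hs
      ((h.2.2 s hs).2.2.2 i t ht)
  have h2 := HasDerivWithinAt.fun_sum (u := Finset.range r) fun β _ =>
    HasDerivWithinAt.fun_sum (u := (Finset.univ : Finset (Fin N))) fun i _ =>
    ((hasDerivWithinAt_expFam_mul_Ds hT (h.contDiffOn_coord β i (zero_mem D))
      (h.contDiffOn_initialMomentum β i) ht hs).sub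
    (hasDerivWithinAt_boundaryFam_mul_Ds hT (h.contDiffOn_coord β i (right_mem D))
      (h.contDiffOn_terminalMomentum β i) 2 1 ht hs)).sub
    (hasDerivWithinAt_boundaryFam_mul_Ds hT
      (contDiffOn_slice (h.contDiffOn_zeroFam β i) (right_mem D))
      (contDiffOn_slice (h.contDiffOn_zeroDerivFam β i) (right_mem D)) 2 1 ht hs)
  refine (h1.add h2).congr_of_mem (fun τ _ => ?_) ht
  simp only [Pi.add_apply]
  rw [Finset.sum_comm, ← Finset.sum_add_distrib]
  refine Finset.sum_congr rfl fun β _ => ?_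
  rw [← Finset.sum_add_distrib]
  refine Finset.sum_congr rfl fun i _ => ?_
  simp only [momentumFam, zeroDerivFam, zeroFam, primeFam, secondFam, Pi.sub_apply]
  ring

theorem labour_integrand_eq (h : D.IsControlledVariation u F) {t s : ℝ} (ht : t ∈ Icc 0 T)
    (hs : s ∈ Icc (0 : ℝ) 1) :
    (∑ a : Fin M, derivWithin (fun s' => u (t, s') a) (Icc 0 1) s *
        fderiv ℝ (D.pontryagin (jet n T (fun τ => F (τ, s)) t)) (u (t, s)) (Pi.single a 1)) -
      derivWithin (fun t' => derivWithin (fun s' => D.muPrime u F t' s') (Icc 0 1) s)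
        (Icc 0 T) t = Dt T (D.labourPotential u F) (t, s) := by
  have hT := D.T_pos
  have hr : r ≤ n := by have := D.order_le; omega
  have hp : (t, s) ∈ rect T := ⟨ht, hs⟩
  have hsum : ∑ a : Fin M, derivWithin (fun s' => u (t, s') a) (Icc 0 1) s *
        fderiv ℝ (D.pontryagin (jet n T (fun τ => F (τ, s)) t)) (u (t, s)) (Pi.single a 1) =
      -∑ a, Ds T u (t, s) a * fderiv ℝ (D.L (jetMap n T F (t, s))) (u (t, s)) (Pi.single a 1) := by
    rw [← Finset.sum_neg_distrib]
    refine Finset.sum_congr rfl fun a _ => ?_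
    rw [(hasDerivWithinAt_pi.1 (hasDerivWithinAt_snd h.1 ht hs) a).derivWithin
      (uniqueDiffOn_Icc one_pos s hs)]
    have hpont : D.pontryagin (jet n T (fun τ => F (τ, s)) t) =
        fun w => -D.L (jetMap n T F (t, s)) w := rfl
    rw [hpont, fderiv_fun_neg]
    simp
  rw [hsum, h.derivWithin_derivWithin_muPrime ht hs, h.Ds_muIntegrand ht hs,
    h.Dt_labourPotential ht hs,
    h.smoothAlong_L.Ds_comp_eq hT hr hp fun i δ hδ => h.pderivAlong_L_eq_zero hp i hδ]
  -- `U` and `X` are the control and jet parts of `∂_s L`, `A` the quadratic part of the derivative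
  -- of the integrand, `B` the correction from `μ'`, and `C` the auxiliary part of `∂W/∂t`. The
  -- control parts cancel; in `A - B` so do the `ω⁴` terms.
  have hrearrange : ∀ U X A B C : ℝ, A - B = C → -U - (-(X + U + A) + B) = X + C := by
    intros; linarith
  refine hrearrange _ _ _ _ _ ?_
  rw [← Finset.sum_sub_distrib]
  refine Finset.sum_congr rfl fun β _ => ?_
  rw [← Finset.sum_sub_distrib]
  refine Finset.sum_congr rfl fun i _ => ?_
  ring

/-- The labour of a controlled variation is the decrease of the terminal cost. -/
theorem labour_eq (h : D.IsControlledVariation u F) :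
    D.labour u F = D.cost (fun t => F (t, 0)) - D.cost (fun t => F (t, 1)) := by
  have hT := D.T_pos
  have hW := h.contDiffOn_labourPotential
  have hC : ContDiffOn ℝ ∞ (fun q => D.C (jetMap n T F q)) (rect T) :=
    h.smoothAlong_C.contDiffOn_comp hT
  have h1 : D.labour u F =
      ∫ t in (0 : ℝ)..T, ∫ s in (0 : ℝ)..1, Dt T (D.labourPotential u F) (t, s) := by
    refine intervalIntegral.integral_congr fun t ht => intervalIntegral.integral_congr
      fun s hs => ?_
    rw [uIcc_of_le hT.le] at ht
    rw [uIcc_of_le zero_le_one] at hs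
    exact h.labour_integrand_eq ht hs
  have h2 : ∀ s ∈ Icc (0 : ℝ) 1, ∫ t in (0 : ℝ)..T, Dt T (D.labourPotential u F) (t, s) =
      -Ds T (fun q => D.C (jetMap n T F q)) (T, s) := by
    intro s hs
    rw [integral_eq_sub_of_hasDerivWithinAt hT (f := fun t => D.labourPotential u F (t, s))
      (fun t ht => hasDerivWithinAt_fst hW ht hs)
      (fun t ht => (hasDerivWithinAt_fst (contDiffOn_Dt hT hW) ht hs).continuousWithinAt),
      h.labourPotential_zero hs, h.labourPotential_right hs, sub_zero]
  -- After exchanging the order, the inner integral in `t` is a difference of boundary values of the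
  -- potential.
  rw [h1, integral_interval_swap (by
    rw [uIcc_of_le hT.le, uIcc_of_le zero_le_one]; exact (contDiffOn_Dt hT hW).continuousOn)]
  have h3 : ∫ s in (0 : ℝ)..1, ∫ t in (0 : ℝ)..T, Dt T (D.labourPotential u F) (t, s) =
      ∫ s in (0 : ℝ)..1, -Ds T (fun q => D.C (jetMap n T F q)) (T, s) :=
    intervalIntegral.integral_congr fun s hs => h2 s (by rwa [uIcc_of_le zero_le_one] at hs)
  rw [h3, intervalIntegral.integral_neg, integral_eq_sub_of_hasDerivWithinAt one_pos
    (f := fun s => D.C (jetMap n T F (T, s)))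
    (fun s hs => hasDerivWithinAt_snd hC (right_mem D) hs)
    (contDiffOn_slice (contDiffOn_Ds hT hC) (right_mem D)).continuousOn, neg_sub]
  rfl

end IsControlledVariation

/-- Derivatives are taken within `[0, T]`, so values outside are irrelevant; start and end
conditions of variations only fix curves there. -/
theorem cost_congr (D : DefiningTriple N M n r T) {q q' : ℝ → Fin N → ℝ}
    (h : EqOn q q' (Icc 0 T)) : D.cost q = D.cost q' := by
  have hT : T ∈ Icc 0 T := right_mem_Icc.2 D.T_pos.le
  simp only [cost, jet, iteratedDerivWithin_congr h hT]

end DefiningTriple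

end MinimalLabour

end

theorem theorem6p4 {N M n r : ℕ} {T : ℝ} (D : MinimalLabour.DefiningTriple N M n r T)
    (q₀ : ℝ → Fin N → ℝ) (hq₀ : D.IsControlledCurve q₀) :
    (D.IsOptimal q₀ →
      ∀ (u : ℝ × ℝ → Fin M → ℝ) (F : ℝ × ℝ → Fin N → ℝ),
        D.IsControlledVariation u F → D.StartsAt F q₀ → D.labour u F ≤ 0) ∧
    ((∀ q q' : ℝ → Fin N → ℝ, D.IsControlledCurve q → D.IsControlledCurve q' →
        ∃ (u : ℝ × ℝ → Fin M → ℝ) (F : ℝ × ℝ → Fin N → ℝ),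
          D.IsControlledVariation u F ∧ D.StartsAt F q ∧ D.EndsAt F q') →
      (∀ (u : ℝ × ℝ → Fin M → ℝ) (F : ℝ × ℝ → Fin N → ℝ),
        D.IsControlledVariation u F → D.StartsAt F q₀ → D.labour u F ≤ 0) →
      D.IsOptimal q₀) := by
  refine ⟨fun hopt u F hV hstart => ?_, fun hconn hlab => ⟨hq₀, fun p hp => ?_⟩⟩
  · rw [hV.labour_eq, D.cost_congr hstart]
    -- The end curve of the variation is itself a competitor.
    have := hopt.2 _ ⟨_, hV.2.2 1 (Set.right_mem_Icc.2 zero_le_one)⟩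
    linarith
  · obtain ⟨u, F, hV, hstart, hend⟩ := hconn q₀ p hq₀ hp
    have := hlab u F hV hstart
    rw [hV.labour_eq, D.cost_congr hstart, D.cost_congr hend] at this
    linarith
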